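/- For an integer $d\ge 1$ and finitely supported $f,g:\mathbb{Z}^d\to[0,\infty)$ write $\|f\|_r=\big(\sum_{x\in\mathbb{Z}^d}|f(x)|^r\big)^{1/r}$ for real $r\ge 1$, and let $(f\,\bar{*}\,g)(z)=\sup_{x\in\mathbb{Z}^d}f(x)\,g(z-x)$ be the sup-convolution. For every $d\ge 1$ the following hold. (1) For all $f,g:\mathbb{Z}^d\to[0,\infty)$ supported on $\{0,1,2\}^d$, $$\|f\,\bar{*}\,g\|_1\ \ge\ \|f\|_q\,\|g\|_q,\qquad q=\frac{2\log 3}{\log 5}.$$ (2) For all $A,B\subseteq\{0,1,2\}^d$, with $A+B=\{a+b: a\in A,\ b\in B\}\subset\mathbb{Z}^d$, $$|A+B|\ \ge\ |A|^p\,|B|^p,\qquad p=\frac{\log 5}{2\log 3},$$ and this power is best possible: $\frac{\log 5}{2\log 3}$ is the largest real number $p$ for which the inequality $|A+B|\ge|A|^p|B|^p$ holds for all $A,B\subseteq\{0,1,2\}^d$. -/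

import Mathlib

open scoped Pointwise

noncomputable section

namespace SumsetCube

/-- The discrete cube `{0, 1, 2}^d`, as a subset of the lattice `ℤ^d`. -/
def cube (d : ℕ) : Set (Fin d → ℤ) := {x | ∀ i, x i = 0 ∨ x i = 1 ∨ x i = 2}

/-- The sup-convolution `z ↦ sup_x f(x) g(z - x)` of two functions on `ℤ^d`. For functions of finite
support the supremum is over finitely many values, hence a genuine one. -/
def supConv {d : ℕ} (f g : (Fin d → ℤ) → ℝ) (z : Fin d → ℤ) : ℝ :=
  ⨆ x : Fin d → ℤ, f x * g (z - x)

/-- The norm `(∑_x |f(x)|^p)^(1/p)` of a finitely supported function on `ℤ^d`, used for `p ≥ 1`. -/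
def ellNorm {d : ℕ} (p : ℝ) (f : (Fin d → ℤ) → ℝ) : ℝ :=
  (∑' x : Fin d → ℤ, |f x| ^ p) ^ (1 / p)

end SumsetCube

end

/-!
Let `q = 2 log 3 / log 5`, so that `3 ^ (2 / q) = 5`. Both parts rest on the case `d = 1`, which
is `‖a ∗̄ b‖₁ ≥ ‖a‖_q ‖b‖_q` for `a, b ∈ [0, ∞)^3` (`dom`). Given it, the inequality in dimension
`d` follows by induction (`lp_mul_lp_le_sum`): slice the functions along one coordinate, apply the
induction hypothesis to pairs of slices, and then the case `d = 1` to the vectors of norms of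
slices. The bound on `|A + B|` is the case of indicator functions, and `A = B = {0, 1, 2}^d` shows
that the exponent is best possible.

For `d = 1`, fix `b` and all but one of the `aᵢ`. The left-hand side is then piecewise affine in
the remaining `aᵢ` and the right-hand side is convex, so only `aᵢ = 0` and the kinks of the
left-hand side need checking (`le_of_le_at_kinks`). Moving the coordinates one after the other to
kinks, for `a` and for `b`, leaves the following pairs, up to scaling and reversal:
* `a` or `b` has a zero entry; then further moves lead to pairs of vectors built from `(1, t)`,
  and to `(1, t, 0)` against `(1, t, t²)` (`dom_pair`, `dom_ends`);
* `a` or `b` is a geometric progression; then one may take `a = b = (1, t, t²)` (`dom_geom`);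
* `a = b = (x, s, y)` (`dom_self`). If `s² ≤ x y`, a convexity argument in `s` reduces to `s = 0`
  and `s² = x y`; if `s² ≥ x y`, the difference of the two sides increases with `s`, which again
  reduces to `s² = x y`;
* `a` is proportional to the entrywise inverse of `b`, reversed (`dom_of_mul_eq`); Minkowski's
  inequality reduces this to a geometric progression.

What remains are the one-variable inequalities `(1 + t^q)^(2/q) ≤ 1 + t + t²` (`two_point_le`) and
`(1 + t^q + t^(2q))^(2/q) ≤ 1 + t + t² + t³ + t⁴` (`geom_le`). The latter is an equality at
`t = 1`, and is shown by a derivative estimate near `1` and by comparison with the exponent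
`4 / 3` away from `1`.
-/

namespace SumsetCube

/-! ### The inequality for geometric progressions and for pairs -/

theorem geom_poly_low {r : ℝ} (h0 : 0 ≤ r) (h1 : r ≤ 3 / 4) :
    (1 + r ^ 4 + r ^ 8) ^ 3 ≤ (1 + r ^ 3 + r ^ 6 + r ^ 9 + r ^ 12) ^ 2 := by
  have key : 0 ≤ 2 - 3 * r + 3 * r ^ 3 - 6 * r ^ 5 + 4 * r ^ 6 - 2 * r ^ 9 + 4 * r ^ 12
      - 6 * r ^ 13 + 3 * r ^ 15 - 3 * r ^ 17 + 2 * r ^ 18 := by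
    have e : 0 ≤ 2 - 3 * r + 3 * r ^ 3 - 6 * r ^ 5 + 4 * r ^ 6 - 2 * r ^ 9 - r ^ 12 := by
      have h3 : r ^ 2 * (6 - 29 / 10 * r) ≤ 54 / 25 := by
        have : 0 ≤ 6 * (3 / 4 + r) - 29 / 10 * (9 / 16 + 3 / 4 * r + r ^ 2) := by nlinarith
        nlinarith [mul_nonneg (sub_nonneg.2 h1) this]
      have h33 : r ^ 3 ≤ (3 / 4) ^ 3 := by gcongr
      have h66 : r ^ 6 ≤ (3 / 4) ^ 6 := by gcongr
      have h6 : 0 ≤ r ^ 6 * (11 / 10 - 2 * r ^ 3 - r ^ 6) :=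
        mul_nonneg (by positivity) (by norm_num at h33 h66; linarith)
      have h5 : 0 ≤ r ^ 3 * (54 / 25 - r ^ 2 * (6 - 29 / 10 * r)) :=
        mul_nonneg (by positivity) (by linarith)
      have h1' : 0 ≤ 2 - 3 * r + 21 / 25 * r ^ 3 := by nlinarith
      nlinarith
    -- the terms of degree at least 12 sum to at least `-r ^ 12`
    have h12 : 0 ≤ r ^ 12 := by positivity
    nlinarith [mul_nonneg h12 (sub_nonneg.2 h1), mul_nonneg h12 (pow_nonneg h0 3),
      mul_nonneg (mul_nonneg h12 (pow_nonneg h0 3)) (sub_nonneg.2 h1),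
      mul_nonneg h12 (pow_nonneg h0 6),
      mul_nonneg (mul_nonneg h12 (pow_nonneg h0 4)) (sub_nonneg.2 h1)]
  nlinarith [mul_nonneg (pow_nonneg h0 3) key]

theorem geom_poly_high {s : ℝ} (h0 : 16 / 25 ≤ s) (h1 : s ≤ 1) :
    0 ≤ -9 + 9 * s - 2 * s ^ 2 - 2 * s ^ 3 + 37 * s ^ 4 + 19 * s ^ 5 + 28 * s ^ 6 - 8 * s ^ 7
      + 16 * s ^ 8 - 8 * s ^ 9 := by
  obtain ⟨t, rfl⟩ : ∃ t, s = 16 / 25 + t := ⟨s - 16 / 25, by ring⟩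
  have ht : 0 ≤ t := by linarith
  have h6 : 0 ≤ (16 / 25 + t) ^ 6 * (1 - (16 / 25 + t)) := by
    apply mul_nonneg <;> [positivity; linarith]
  have h8 : 0 ≤ (16 / 25 + t) ^ 8 * (1 - (16 / 25 + t)) := by
    apply mul_nonneg <;> [positivity; linarith]
  have h8' : 0 ≤ (16 / 25 + t) ^ 8 := by positivity
  have h6' : 0 ≤ (16 / 25 + t) ^ 6 := by positivity
  have h5' : 0 ≤ (16 / 25 + t) ^ 5 := by positivity
  have : 0 ≤ -9 + 9 * (16 / 25 + t) - 2 * (16 / 25 + t) ^ 2 - 2 * (16 / 25 + t) ^ 3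
     + 37 * (16 / 25 + t) ^ 4 := by
    ring_nf
    positivity
  linarith

/-- A rational lower bound for `τ ^ q`, `τ = s²`: weighted AM-GM gives `s ^ (1/4) ≤ (s + 3) / 4`, and
`τ ^ q ≥ s ^ (11/4)`. -/
theorem sq_rpow_lower {q s : ℝ} (hq : q ≤ 11 / 8) (h0 : 0 < s) (h1 : s ≤ 1) :
    4 * s ^ 3 / (s + 3) ≤ (s ^ 2) ^ q := by
  have h2 : (s ^ 2) ^ q = s ^ (2 * q) := by
    rw [← Real.rpow_natCast, ← Real.rpow_mul h0.le]; norm_num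
  have h3 : s ^ (11 / 4 : ℝ) ≤ s ^ (2 * q) :=
    Real.rpow_le_rpow_of_exponent_ge h0 h1 (by linarith)
  rw [h2]
  refine le_trans ?_ h3
  have h4 := Real.geom_mean_le_arith_mean2_weighted (w₁ := 1/4) (w₂ := 3/4) (p₁ := s) (p₂ := 1)
    (by norm_num) (by norm_num) h0.le (by norm_num) (by norm_num)
  rw [Real.one_rpow, mul_one] at h4
  have h5 : s ^ (11 / 4 : ℝ) * s ^ (1 / 4 : ℝ) = s ^ 3 := by
    rw [← Real.rpow_add h0, ← Real.rpow_natCast]; norm_num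
  rw [div_le_iff₀ (by linarith), ← h5]
  have := Real.rpow_pos_of_pos h0 (11 / 4 : ℝ)
  nlinarith

/-- With denominators cleared, this says that
`t ↦ log (1 + t + t² + t³ + t⁴) - (2/q) log (1 + t^q + t^(2q))` has nonpositive derivative.
After replacing `t ^ q` by its rational lower bound in `√t`, the factor `1 - √t` splits off and a
polynomial that is nonnegative on `[16/25, 1]` remains. -/
theorem geom_deriv_nonpos {q t : ℝ} (hq : q ≤ 11 / 8) (h0 : 27 / 64 ≤ t) (h1 : t ≤ 1) :
    (t + 2 * t ^ 2 + 3 * t ^ 3 + 4 * t ^ 4) * (1 + t ^ q + (t ^ q) ^ 2) ≤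
      2 * (t ^ q + 2 * (t ^ q) ^ 2) * (1 + t + t ^ 2 + t ^ 3 + t ^ 4) := by
  obtain ⟨s, hs, rfl⟩ : ∃ s, 0 ≤ s ∧ t = s ^ 2 :=
    ⟨√t, Real.sqrt_nonneg _, (Real.sq_sqrt (by linarith)).symm⟩
  have hs1 : s ≤ 1 := by nlinarith
  have hs0 : 16 / 25 ≤ s := by nlinarith
  have hw := sq_rpow_lower hq (by linarith) hs1
  set w := (s ^ 2) ^ q
  set v := 4 * s ^ 3 / (s + 3) with hv
  have hv0 : 0 ≤ v := by positivity
  have hP : (2 + s ^ 2 - s ^ 6 - 2 * s ^ 8) * (1 + v + v ^ 2) -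
      2 * (1 - v ^ 2) * (1 + s ^ 2 + s ^ 4 + s ^ 6 + s ^ 8) =
      s ^ 2 * (1 - s) * (-9 + 9 * s - 2 * s ^ 2 - 2 * s ^ 3 + 37 * s ^ 4 + 19 * s ^ 5 + 28 * s ^ 6
       - 8 * s ^ 7 + 16 * s ^ 8 - 8 * s ^ 9) / (s + 3) ^ 2 := by
    rw [hv]; field_simp; ring
  have hP' : 0 ≤ (2 + s ^ 2 - s ^ 6 - 2 * s ^ 8) * (1 + v + v ^ 2) -
      2 * (1 - v ^ 2) * (1 + s ^ 2 + s ^ 4 + s ^ 6 + s ^ 8) := by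
    rw [hP]
    have := geom_poly_high hs0 hs1
    have := sub_nonneg.2 hs1
    positivity
  have hA : 0 ≤ 2 + s ^ 2 - s ^ 6 - 2 * s ^ 8 := by
    have h6 : s ^ 6 ≤ s ^ 2 := pow_le_pow_of_le_one hs hs1 (by norm_num)
    have h8 : s ^ 8 ≤ 1 := pow_le_one₀ hs hs1
    linarith
  have hB : 0 ≤ 2 * (1 + s ^ 2 + s ^ 4 + s ^ 6 + s ^ 8) := by positivity
  have hww : v ^ 2 ≤ w ^ 2 := by gcongr
  have := mul_nonneg hA (by linarith : 0 ≤ (1 + w + w ^ 2) - (1 + v + v ^ 2))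
  have := mul_nonneg hB (by linarith : 0 ≤ w ^ 2 - v ^ 2)
  nlinarith

/-- Equality holds at `t = 1` by the choice of `q`, so near `1` the exponent cannot be replaced by a
rational one; instead the logarithm of the quotient is shown to be decreasing. -/
theorem geom_le_of_near_one {q t : ℝ} (hq0 : 4 / 3 ≤ q) (hq : q ≤ 11 / 8)
    (hlog : 2 * Real.log 3 = q * Real.log 5) (h0 : 27 / 64 ≤ t) (h1 : t ≤ 1) :
    (1 + t ^ q + (t ^ q) ^ 2) ^ (2 / q) ≤ 1 + t + t ^ 2 + t ^ 3 + t ^ 4 := by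
  have hq00 : 0 < q := by linarith
  let g : ℝ → ℝ := fun t => Real.log (1 + t + t ^ 2 + t ^ 3 + t ^ 4) -
    2 / q * Real.log (1 + t ^ q + (t ^ q) ^ 2)
  have hg : ∀ t, 27 / 64 ≤ t → HasDerivAt g
      ((1 + 2 * t + 3 * t ^ 2 + 4 * t ^ 3) / (1 + t + t ^ 2 + t ^ 3 + t ^ 4) -
        2 / q * ((q * t ^ (q - 1) + 2 * t ^ q * (q * t ^ (q - 1))) /
          (1 + t ^ q + (t ^ q) ^ 2))) t := by
    intro t ht
    have ht0 : 0 < t := by linarith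
    have hp : HasDerivAt (fun t : ℝ => t ^ q) (q * t ^ (q - 1)) t :=
      Real.hasDerivAt_rpow_const (Or.inl ht0.ne')
    have hw : 0 < t ^ q := Real.rpow_pos_of_pos ht0 q
    have hK : HasDerivAt (fun t : ℝ => 1 + t + t ^ 2 + t ^ 3 + t ^ 4)
        (1 + 2 * t + 3 * t ^ 2 + 4 * t ^ 3) t := by
      have := (((hasDerivAt_id t).const_add 1).add (hasDerivAt_pow 2 t)).add (hasDerivAt_pow 3 t)
        |>.add (hasDerivAt_pow 4 t)
      exact this.congr_deriv (by norm_num)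
    have hR : HasDerivAt (fun t : ℝ => 1 + t ^ q + (t ^ q) ^ 2)
        (q * t ^ (q - 1) + 2 * t ^ q * (q * t ^ (q - 1))) t := by
      have := (hp.const_add 1).add (hp.pow 2)
      exact this.congr_deriv (by norm_num)
    exact (hK.log (by positivity)).sub ((hR.log (by positivity)).const_mul _)
  have hanti : AntitoneOn g (Set.Icc (27 / 64) 1) := by
    apply antitoneOn_of_deriv_nonpos (convex_Icc _ _)
    · intro x hx; exact (hg x hx.1).continuousAt.continuousWithinAt
    · intro x hx; rw [interior_Icc] at hx
      exact (hg x hx.1.le).differentiableAt.differentiableWithinAt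
    · intro x hx; rw [interior_Icc] at hx
      rw [(hg x hx.1.le).deriv]
      have hx0 : 0 < x := by linarith [hx.1]
      have hw : 0 < x ^ q := Real.rpow_pos_of_pos hx0 q
      rw [Real.rpow_sub_one hx0.ne']
      have := geom_deriv_nonpos hq hx.1.le hx.2.le
      rw [sub_nonpos]
      have e : 2 / q * ((q * (x ^ q / x) + 2 * x ^ q * (q * (x ^ q / x))) /
          (1 + x ^ q + (x ^ q) ^ 2)) =
          (2 * (x ^ q + 2 * (x ^ q) ^ 2) / x) / (1 + x ^ q + (x ^ q) ^ 2) := by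
        field_simp
      rw [e, div_le_div_iff₀ (by positivity) (by positivity), div_mul_eq_mul_div,
        le_div_iff₀ hx0]
      linarith
  have h := hanti ⟨h0, h1⟩ ⟨by norm_num, le_rfl⟩ h1
  have ht0 : 0 < t := by linarith
  have hw : 0 < t ^ q := Real.rpow_pos_of_pos ht0 q
  have g1 : g 1 = 0 := by
    simp only [g, Real.one_rpow]
    norm_num
    field_simp
    linarith
  rw [g1] at h
  rw [← Real.log_le_log_iff (by positivity) (by positivity), Real.log_rpow (by positivity)]
  simp only [g] at h
  linarith



/-- Away from `t = 1` the inequality already holds with `4 / 3` in place of `q`, which turns it into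
a polynomial inequality in `t ^ (1/3)`. -/
theorem geom_le_of_small {q t : ℝ} (hq0 : 4 / 3 ≤ q) (h0 : 0 ≤ t) (h1 : t ≤ 27 / 64) :
    (1 + t ^ q + (t ^ q) ^ 2) ^ (2 / q) ≤ 1 + t + t ^ 2 + t ^ 3 + t ^ 4 := by
  obtain ⟨r, hr, rfl⟩ : ∃ r, 0 ≤ r ∧ t = r ^ 3 :=
    ⟨t ^ (1 / 3 : ℝ), by positivity, by rw [← Real.rpow_natCast, ← Real.rpow_mul h0]; norm_num⟩
  have hr1 : r ≤ 3 / 4 := by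
    by_contra! h
    have : (3 / 4 : ℝ) ^ 3 < r ^ 3 := by gcongr
    norm_num at this; linarith
  have hw : (r ^ 3) ^ q ≤ r ^ 4 := by
    refine (Real.rpow_le_rpow_of_exponent_ge' h0 (by linarith) (by norm_num) hq0).trans_eq ?_
    rw [← Real.rpow_natCast, ← Real.rpow_mul hr, ← Real.rpow_natCast]; norm_num
  have hw0 : 0 ≤ (r ^ 3) ^ q := by positivity
  calc (1 + (r ^ 3) ^ q + ((r ^ 3) ^ q) ^ 2) ^ (2 / q)
      ≤ (1 + r ^ 4 + (r ^ 4) ^ 2) ^ (2 / q) := by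
        have : 0 < q := by linarith
        gcongr
    _ ≤ (1 + r ^ 4 + (r ^ 4) ^ 2) ^ (3 / 2 : ℝ) := by
        apply Real.rpow_le_rpow_of_exponent_le
        · have : 0 ≤ r ^ 4 := by positivity
          nlinarith
        · rw [div_le_div_iff₀ (by linarith) (by norm_num)]; linarith
    _ = √((1 + r ^ 4 + r ^ 8) ^ 3) := by
        rw [Real.sqrt_eq_rpow, ← Real.rpow_natCast _ 3, ← Real.rpow_mul (by positivity)]
        norm_num; ring_nf
    _ ≤ 1 + r ^ 3 + r ^ 6 + r ^ 9 + r ^ 12 := by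
        rw [Real.sqrt_le_left (by positivity)]
        exact geom_poly_low hr hr1
    _ = _ := by ring

/-- The case `a = b = (1, t, t²)` of the one-dimensional inequality. It is invariant under `t ↦ 1 / t`,
so the two ranges of `t` treated above suffice. -/
theorem geom_le {q t : ℝ} (hq0 : 4 / 3 ≤ q) (hq : q ≤ 11 / 8)
    (hlog : 2 * Real.log 3 = q * Real.log 5) (h0 : 0 ≤ t) :
    (1 + t ^ q + (t ^ q) ^ 2) ^ (2 / q) ≤ 1 + t + t ^ 2 + t ^ 3 + t ^ 4 := by
  have main : ∀ t : ℝ, 0 ≤ t → t ≤ 1 →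
      (1 + t ^ q + (t ^ q) ^ 2) ^ (2 / q) ≤ 1 + t + t ^ 2 + t ^ 3 + t ^ 4 := by
    intro t h0 h1
    rcases le_total t (27 / 64) with h | h
    · exact geom_le_of_small hq0 h0 h
    · exact geom_le_of_near_one hq0 hq hlog h h1
  rcases le_total t 1 with h | h
  · exact main t h0 h
  have ht : 0 < t := by linarith
  have h2 := main t⁻¹ (by positivity) (inv_le_one_of_one_le₀ h)
  have hw : 0 < t ^ q := by positivity
  have e : (1 + t⁻¹ ^ q + (t⁻¹ ^ q) ^ 2) = (1 + t ^ q + (t ^ q) ^ 2) * (t⁻¹ ^ q) ^ 2 := by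
    rw [Real.inv_rpow h0]; field_simp; ring
  have hq00 : q ≠ 0 := by linarith
  have e2 : ((t⁻¹ ^ q) ^ 2) ^ (2 / q) = t⁻¹ ^ 4 := by
    rw [← Real.rpow_natCast, ← Real.rpow_mul (by positivity), ← Real.rpow_mul (by positivity),
      ← Real.rpow_natCast]
    congr 1; push_cast; field_simp; norm_num
  rw [e, Real.mul_rpow (by positivity) (by positivity), e2] at h2
  have := mul_le_mul_of_nonneg_right h2 (by positivity : 0 ≤ t ^ 4)
  have e3 : (1 + t ^ q + (t ^ q) ^ 2) ^ (2 / q) * t⁻¹ ^ 4 * t ^ 4 =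
    (1 + t ^ q + (t ^ q) ^ 2) ^ (2 / q) := by field_simp
  have e4 : (1 + t⁻¹ + t⁻¹ ^ 2 + t⁻¹ ^ 3 + t⁻¹ ^ 4) * t ^ 4 = 1 + t + t ^ 2 + t ^ 3 + t ^ 4 := by
    field_simp; ring
  rwa [e3, e4] at this

theorem two_point_poly {r : ℝ} (h0 : 0 ≤ r) : (1 + r ^ 4) ^ 3 ≤ (1 + r ^ 3 + r ^ 6) ^ 2 := by
  have key : 0 ≤ 2 - 3 * r + 3 * r ^ 3 - 3 * r ^ 5 + 2 * r ^ 6 := by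
    nlinarith [sq_nonneg (r - 1), sq_nonneg (r ^ 2 - 1), sq_nonneg (r ^ 3 - 1),
      sq_nonneg (r ^ 3 - r), sq_nonneg (r ^ 3 - r ^ 2), mul_nonneg h0 (sq_nonneg (r - 1)),
      mul_nonneg h0 (sq_nonneg (r ^ 2 - 1)), mul_nonneg h0 (sq_nonneg (r ^ 2 - r)),
      sq_nonneg (r ^ 2 - r)]
  nlinarith [mul_nonneg (pow_nonneg h0 3) key]

/-- The case `a = b = (1, t, 0)`. It is not sharp: `ℓ^q` norms decrease in `q`, so `q` may be replaced by
`4 / 3`. -/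
theorem two_point_le {q t : ℝ} (hq0 : 4 / 3 ≤ q) (h0 : 0 ≤ t) :
    (1 + t ^ q) ^ (2 / q) ≤ 1 + t + t ^ 2 := by
  obtain ⟨r, hr, rfl⟩ : ∃ r, 0 ≤ r ∧ t = r ^ 3 :=
    ⟨t ^ (1 / 3 : ℝ), by positivity, by rw [← Real.rpow_natCast, ← Real.rpow_mul h0]; norm_num⟩
  have h := Real.rpow_add_rpow_le (p := 4 / 3) (q := q) (a := 1) (b := r ^ 3) zero_le_one h0
    (by norm_num) hq0
  rw [Real.one_rpow, Real.one_rpow] at h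
  have hw : (r ^ 3) ^ (4 / 3 : ℝ) = r ^ 4 := by
    rw [← Real.rpow_natCast, ← Real.rpow_mul hr, ← Real.rpow_natCast]; norm_num
  rw [hw] at h
  have hw0 : 0 ≤ (r ^ 3) ^ q := by positivity
  calc (1 + (r ^ 3) ^ q) ^ (2 / q) = ((1 + (r ^ 3) ^ q) ^ (1 / q)) ^ 2 := by
        rw [← Real.rpow_natCast _ 2, ← Real.rpow_mul (by positivity)]; congr 1; push_cast; ring
    _ ≤ ((1 + r ^ 4) ^ (1 / (4 / 3) : ℝ)) ^ 2 := by gcongr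
    _ = √((1 + r ^ 4) ^ 3) := by
        rw [Real.sqrt_eq_rpow, ← Real.rpow_natCast _ 3, ← Real.rpow_mul (by positivity),
          ← Real.rpow_natCast, ← Real.rpow_mul (by positivity)]
        norm_num
    _ ≤ 1 + r ^ 3 + r ^ 6 := by
        rw [Real.sqrt_le_left (by positivity)]
        exact two_point_poly hr
    _ = _ := by ring

/-! ### Convex against piecewise affine functions -/

/-- On a segment, a convex function lies below an affine function as soon as it does so at both
endpoints. -/
theorem le_affine_of_endpoints {M : ℝ → ℝ} (hM : ConvexOn ℝ (Set.Ici 0) M) {c₀ c₁ u v s : ℝ}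
    (hu : 0 ≤ u) (h1 : M u ≤ c₀ + c₁ * u) (h2 : M v ≤ c₀ + c₁ * v) (hus : u ≤ s) (hsv : s ≤ v) :
    M s ≤ c₀ + c₁ * s := by
  have hg : ConvexOn ℝ (Set.Ici 0) (fun s => M s - (c₀ + c₁ * s)) := by
    refine hM.sub ⟨convex_Ici 0, fun x _ y _ a b _ _ hab => ?_⟩
    simp only [smul_eq_mul]
    linear_combination c₀ * hab
  have := hg.le_max_of_mem_Icc hu (hu.trans (hus.trans hsv)) ⟨hus, hsv⟩
  have h3 : max (M u - (c₀ + c₁ * u)) (M v - (c₀ + c₁ * v)) ≤ 0 :=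
    max_le (by linarith) (by linarith)
  linarith

/-- To bound `M` by `F` plus an affine function on a segment in `[0, ∞)`, it suffices to do so at the
endpoints and at the points of `S`. -/
def SegmentTest (M F : ℝ → ℝ) (S : Set ℝ) : Prop :=
  ∀ c₀ c₁ u v, 0 ≤ u → M u ≤ F u + (c₀ + c₁ * u) → M v ≤ F v + (c₀ + c₁ * v) →
    (∀ k ∈ S, u ≤ k → k ≤ v → M k ≤ F k + (c₀ + c₁ * k)) →
    ∀ s, u ≤ s → s ≤ v → M s ≤ F s + (c₀ + c₁ * s)

theorem segmentTest_zero {M : ℝ → ℝ} (hM : ConvexOn ℝ (Set.Ici 0) M) :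
    SegmentTest M (fun _ => 0) ∅ := by
  intro c₀ c₁ u v hu h1 h2 _ s hus hsv
  rw [zero_add] at *
  exact le_affine_of_endpoints hM hu h1 h2 hus hsv

/-- Adding `s ↦ max p (q s)` to `F` costs one more test point: `p / q`, where the maximum switches. -/
theorem SegmentTest.add_max {M F : ℝ → ℝ} {S : Set ℝ} (h : SegmentTest M F S) {p q : ℝ}
    (hp : 0 ≤ p) (hq : 0 ≤ q) :
    SegmentTest M (fun s => F s + max p (q * s)) (insert (p / q) S) := by
  -- on segments that lie on one side of `p / q` the new term is affine
  have left : ∀ c₀ c₁ u v, 0 ≤ u → q * v ≤ p → M u ≤ F u + max p (q * u) + (c₀ + c₁ * u) →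
      M v ≤ F v + max p (q * v) + (c₀ + c₁ * v) →
      (∀ k ∈ S, u ≤ k → k ≤ v → M k ≤ F k + max p (q * k) + (c₀ + c₁ * k)) →
      ∀ s, u ≤ s → s ≤ v → M s ≤ F s + max p (q * s) + (c₀ + c₁ * s) := by
    intro c₀ c₁ u v hu hv h1 h2 h3 s hus hsv
    have e : ∀ t, t ≤ v → F t + max p (q * t) + (c₀ + c₁ * t) = F t + ((c₀ + p) + c₁ * t) := by
      intro t ht
      rw [max_eq_left ((mul_le_mul_of_nonneg_left ht hq).trans hv)]; ring
    rw [e _ hsv]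
    rw [e _ (hus.trans hsv)] at h1
    rw [e _ le_rfl] at h2
    exact h _ _ u v hu h1 h2 (fun k hk hku hkv => (h3 k hk hku hkv).trans_eq (e _ hkv)) s hus hsv
  have right : ∀ c₀ c₁ u v, 0 ≤ u → p ≤ q * u → M u ≤ F u + max p (q * u) + (c₀ + c₁ * u) →
      M v ≤ F v + max p (q * v) + (c₀ + c₁ * v) →
      (∀ k ∈ S, u ≤ k → k ≤ v → M k ≤ F k + max p (q * k) + (c₀ + c₁ * k)) →
      ∀ s, u ≤ s → s ≤ v → M s ≤ F s + max p (q * s) + (c₀ + c₁ * s) := by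
    intro c₀ c₁ u v hu hv h1 h2 h3 s hus hsv
    have e : ∀ t, u ≤ t → F t + max p (q * t) + (c₀ + c₁ * t) = F t + (c₀ + (c₁ + q) * t) := by
      intro t ht
      rw [max_eq_right (hv.trans (mul_le_mul_of_nonneg_left ht hq))]; ring
    rw [e _ hus]
    rw [e _ le_rfl] at h1
    rw [e _ (hus.trans hsv)] at h2
    exact h _ _ u v hu h1 h2 (fun k hk hku hkv => (h3 k hk hku hkv).trans_eq (e _ hku)) s hus hsv
  intro c₀ c₁ u v hu h1 h2 h3 s hus hsv
  have h3' := fun k hk => h3 k (Set.mem_insert_of_mem _ hk)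
  rcases le_total (q * v) p with hv | hv
  · exact left c₀ c₁ u v hu hv h1 h2 h3' s hus hsv
  rcases le_total p (q * u) with hu' | hu'
  · exact right c₀ c₁ u v hu hu' h1 h2 h3' s hus hsv
  rcases hq.eq_or_lt with rfl | hq
  · exact left c₀ c₁ u v hu (by simpa using hp) h1 h2 h3' s hus hsv
  have hk1 : u ≤ p / q := by rw [le_div_iff₀ hq]; linarith
  have hk2 : p / q ≤ v := by rw [div_le_iff₀ hq]; linarith
  have hk := h3 _ (Set.mem_insert _ _) hk1 hk2
  have ek : q * (p / q) = p := by field_simp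
  rcases le_total s (p / q) with hs | hs
  · exact left c₀ c₁ u _ hu ek.le h1 hk (fun k hk hku hkv => h3' k hk hku (hkv.trans hk2)) s hus hs
  · exact right c₀ c₁ _ v (hu.trans hk1) ek.ge hk h2
      (fun k hk hku hkv => h3' k hk (hk1.trans hku) hkv) s hs hsv

/-- A convex function on `[0, ∞)` lies below the piecewise affine function
`c₀ + c₁ s + ∑ max pᵢ (qᵢ s)` as soon as it does so at `0` and at the kinks `pᵢ / qᵢ`, and grows at
most as fast. (If `qᵢ = 0` then `pᵢ / qᵢ = 0` is no additional point.) -/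
theorem le_of_le_at_kinks {M : ℝ → ℝ} (hM : ConvexOn ℝ (Set.Ici 0) M)
    {c₀ c₁ p₁ q₁ p₂ q₂ p₃ q₃ : ℝ} (hp₁ : 0 ≤ p₁) (hq₁ : 0 ≤ q₁) (hp₂ : 0 ≤ p₂) (hq₂ : 0 ≤ q₂)
    (hp₃ : 0 ≤ p₃) (hq₃ : 0 ≤ q₃)
    (hgrow : ∀ s δ, 0 ≤ s → 0 ≤ δ → M (s + δ) ≤ M s + δ * (c₁ + q₁ + q₂ + q₃))
    {f : ℝ → ℝ} (hf : ∀ s, f s = c₀ + c₁ * s + max p₁ (q₁ * s) + max p₂ (q₂ * s) + max p₃ (q₃ * s))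
    (h0 : M 0 ≤ f 0) (h1 : M (p₁ / q₁) ≤ f (p₁ / q₁)) (h2 : M (p₂ / q₂) ≤ f (p₂ / q₂))
    (h3 : M (p₃ / q₃) ≤ f (p₃ / q₃)) {s : ℝ} (hs : 0 ≤ s) : M s ≤ f s := by
  have hf' : ∀ s, f s =
      0 + max p₁ (q₁ * s) + max p₂ (q₂ * s) + max p₃ (q₃ * s) + (c₀ + c₁ * s) := by
    intro s; rw [hf]; ring
  have T := (((segmentTest_zero hM).add_max hp₁ hq₁).add_max hp₂ hq₂).add_max hp₃ hq₃
  have hm : ∃ m, 0 ≤ m ∧ M m ≤ f m ∧ p₁ / q₁ ≤ m ∧ p₂ / q₂ ≤ m ∧ p₃ / q₃ ≤ m := by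
    have k1 : 0 ≤ p₁ / q₁ := by positivity
    have k2 : 0 ≤ p₂ / q₂ := by positivity
    have k3 : 0 ≤ p₃ / q₃ := by positivity
    rcases le_total (p₁ / q₁) (p₂ / q₂) with h | h
    · rcases le_total (p₂ / q₂) (p₃ / q₃) with h' | h'
      · exact ⟨_, k3, h3, h.trans h', h', le_rfl⟩
      · exact ⟨_, k2, h2, h, le_rfl, h'⟩
    · rcases le_total (p₁ / q₁) (p₃ / q₃) with h' | h'
      · exact ⟨_, k3, h3, h', h.trans h', le_rfl⟩
      · exact ⟨_, k1, h1, le_rfl, h, h'⟩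
  obtain ⟨m, hm0, hMm, m1, m2, m3⟩ := hm
  rcases le_total s m with hsm | hsm
  · rw [hf'] at hMm h0 h1 h2 h3 ⊢
    refine T c₀ c₁ 0 m le_rfl h0 hMm ?_ s hs hsm
    intro k hk _ _
    simp only [Set.mem_insert_iff, Set.mem_empty_iff_false, or_false] at hk
    rcases hk with rfl | rfl | rfl
    exacts [h3, h2, h1]
  · have h4 := hgrow m (s - m) hm0 (by linarith)
    rw [add_sub_cancel] at h4
    refine h4.trans ?_
    -- beyond the last kink the slope of each maximum is at least its final slope
    have step : ∀ p q : ℝ, 0 ≤ q → p / q ≤ m → max p (q * m) + q * (s - m) ≤ max p (q * s) := by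
      intro p q hq hpq
      rcases hq.eq_or_lt with rfl | hq
      · simp
      · rw [div_le_iff₀ hq] at hpq
        rw [max_eq_right (by linarith)]
        exact le_trans (by linarith) (le_max_right _ _)
    have := step p₁ q₁ hq₁ m1
    have := step p₂ q₂ hq₂ m2
    have := step p₃ q₃ hq₃ m3
    rw [hf] at hMm ⊢
    linarith

/-! ### The norm of a vector of length three -/

/-- The `ℓ^q` norm of a vector in `[0, ∞)^3`. -/
noncomputable def norm3 (q a₀ a₁ a₂ : ℝ) : ℝ := (a₀ ^ q + a₁ ^ q + a₂ ^ q) ^ (1 / q)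

theorem norm3_nonneg {q a₀ a₁ a₂ : ℝ} (h₀ : 0 ≤ a₀) (h₁ : 0 ≤ a₁) (h₂ : 0 ≤ a₂) :
    0 ≤ norm3 q a₀ a₁ a₂ := by unfold norm3; positivity

theorem norm3_reverse (q a₀ a₁ a₂ : ℝ) : norm3 q a₂ a₁ a₀ = norm3 q a₀ a₁ a₂ := by
  unfold norm3; congr 1; ring

theorem norm3_swap (q a₀ a₁ a₂ : ℝ) : norm3 q a₁ a₀ a₂ = norm3 q a₀ a₁ a₂ := by
  unfold norm3; congr 1; ring

theorem norm3_smul {q c a₀ a₁ a₂ : ℝ} (hq : 0 < q) (hc : 0 ≤ c) (h₀ : 0 ≤ a₀) (h₁ : 0 ≤ a₁)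
    (h₂ : 0 ≤ a₂) : norm3 q (c * a₀) (c * a₁) (c * a₂) = c * norm3 q a₀ a₁ a₂ := by
  unfold norm3
  rw [Real.mul_rpow hc h₀, Real.mul_rpow hc h₁, Real.mul_rpow hc h₂, ← mul_add, ← mul_add,
    Real.mul_rpow (by positivity) (by positivity), ← Real.rpow_mul hc, mul_one_div_cancel hq.ne',
    Real.rpow_one]

theorem norm3_add_le {q a₀ a₁ a₂ b₀ b₁ b₂ : ℝ} (hq : 1 ≤ q) (ha₀ : 0 ≤ a₀) (ha₁ : 0 ≤ a₁)
    (ha₂ : 0 ≤ a₂) (hb₀ : 0 ≤ b₀) (hb₁ : 0 ≤ b₁) (hb₂ : 0 ≤ b₂) :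
    norm3 q (a₀ + b₀) (a₁ + b₁) (a₂ + b₂) ≤ norm3 q a₀ a₁ a₂ + norm3 q b₀ b₁ b₂ := by
  have := Real.Lp_add_le_of_nonneg (s := (Finset.univ : Finset (Fin 3))) (f := ![a₀, a₁, a₂])
    (g := ![b₀, b₁, b₂]) hq (by intro i _; fin_cases i <;> simpa)
    (by intro i _; fin_cases i <;> simpa)
  simpa [Fin.sum_univ_three, norm3] using this

theorem norm3_mono {q a₀ a₁ a₂ b₀ b₁ b₂ : ℝ} (hq : 0 < q) (ha₀ : 0 ≤ a₀) (ha₁ : 0 ≤ a₁)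
    (ha₂ : 0 ≤ a₂) (h₀ : a₀ ≤ b₀) (h₁ : a₁ ≤ b₁) (h₂ : a₂ ≤ b₂) :
    norm3 q a₀ a₁ a₂ ≤ norm3 q b₀ b₁ b₂ := by
  unfold norm3; gcongr

theorem norm3_single {q a : ℝ} (hq : 0 < q) (ha : 0 ≤ a) : norm3 q a 0 0 = a := by
  unfold norm3
  rw [Real.zero_rpow hq.ne', add_zero, add_zero, ← Real.rpow_mul ha, mul_one_div_cancel hq.ne',
    Real.rpow_one]

theorem norm3_add_first_le {q a₀ a₁ a₂ δ : ℝ} (hq : 1 ≤ q) (ha₀ : 0 ≤ a₀) (ha₁ : 0 ≤ a₁)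
    (ha₂ : 0 ≤ a₂) (hδ : 0 ≤ δ) : norm3 q (a₀ + δ) a₁ a₂ ≤ norm3 q a₀ a₁ a₂ + δ := by
  have := norm3_add_le hq ha₀ ha₁ ha₂ hδ le_rfl le_rfl
  rwa [add_zero, add_zero, norm3_single (by linarith) hδ] at this

theorem norm3_le_sum {q a₀ a₁ a₂ : ℝ} (hq : 1 ≤ q) (ha₀ : 0 ≤ a₀) (ha₁ : 0 ≤ a₁) (ha₂ : 0 ≤ a₂) :
    norm3 q a₀ a₁ a₂ ≤ a₀ + a₁ + a₂ := by
  have h1 := norm3_add_first_le hq le_rfl ha₁ ha₂ ha₀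
  have h2 := norm3_add_first_le hq le_rfl le_rfl ha₂ ha₁
  have h3 := norm3_single (q := q) (by linarith) ha₂
  rw [zero_add] at h1 h2
  rw [norm3_swap] at h2
  rw [← norm3_reverse] at h3
  linarith

theorem norm3_convexOn {q a₁ a₂ : ℝ} (hq : 1 ≤ q) (ha₁ : 0 ≤ a₁) (ha₂ : 0 ≤ a₂) :
    ConvexOn ℝ (Set.Ici 0) (fun s => norm3 q s a₁ a₂) := by
  refine ⟨convex_Ici 0, fun x hx y hy a b ha hb hab => ?_⟩
  simp only [smul_eq_mul]
  have hx : 0 ≤ x := hx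
  have hy : 0 ≤ y := hy
  have h := norm3_add_le hq (mul_nonneg ha hx) (mul_nonneg ha ha₁) (mul_nonneg ha ha₂)
    (mul_nonneg hb hy) (mul_nonneg hb ha₁) (mul_nonneg hb ha₂)
  rw [norm3_smul (by linarith) ha hx ha₁ ha₂, norm3_smul (by linarith) hb hy ha₁ ha₂,
    ← add_mul, ← add_mul, hab, one_mul, one_mul] at h
  exact h

/-! ### The one-dimensional inequality and its kinks -/

section OneDimensional

/-- The sum of the sup-convolution of two vectors in `[0, ∞)^3`, seen as functions on
`{0, 1, 2} ⊆ ℤ`. -/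
noncomputable def conv3 (a₀ a₁ a₂ b₀ b₁ b₂ : ℝ) : ℝ :=
  a₀ * b₀ + max (a₀ * b₁) (a₁ * b₀) + max (a₁ * b₁) (max (a₀ * b₂) (a₂ * b₀)) +
    max (a₁ * b₂) (a₂ * b₁) + a₂ * b₂

/-- The inequality `‖a ∗̄ b‖₁ ≥ ‖a‖_q ‖b‖_q` for two vectors in `[0, ∞)^3`. -/
def Dom (q a₀ a₁ a₂ b₀ b₁ b₂ : ℝ) : Prop :=
  norm3 q a₀ a₁ a₂ * norm3 q b₀ b₁ b₂ ≤ conv3 a₀ a₁ a₂ b₀ b₁ b₂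

variable {q a₀ a₁ a₂ b₀ b₁ b₂ : ℝ}

theorem Dom.swap (h : Dom q a₀ a₁ a₂ b₀ b₁ b₂) : Dom q b₀ b₁ b₂ a₀ a₁ a₂ := by
  unfold Dom conv3 at *
  rw [mul_comm (norm3 _ _ _ _), mul_comm b₀ a₀, mul_comm b₀ a₁, mul_comm b₁ a₀, mul_comm b₁ a₁,
    mul_comm b₀ a₂, mul_comm b₂ a₀, mul_comm b₁ a₂, mul_comm b₂ a₁, mul_comm b₂ a₂,
    max_comm (a₁ * b₀), max_comm (a₂ * b₀), max_comm (a₂ * b₁)]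
  exact h

theorem Dom.reverse (h : Dom q a₀ a₁ a₂ b₀ b₁ b₂) : Dom q a₂ a₁ a₀ b₂ b₁ b₀ := by
  unfold Dom conv3 at *
  rw [norm3_reverse q a₀, norm3_reverse q b₀, max_comm (a₂ * b₁), max_comm (a₂ * b₀),
    max_comm (a₁ * b₀)]
  linarith

theorem Dom.smul_left {c : ℝ} (hq : 0 < q) (hc : 0 ≤ c) (h₀ : 0 ≤ a₀) (h₁ : 0 ≤ a₁) (h₂ : 0 ≤ a₂)
    (h : Dom q a₀ a₁ a₂ b₀ b₁ b₂) : Dom q (c * a₀) (c * a₁) (c * a₂) b₀ b₁ b₂ := by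
  unfold Dom at *
  rw [norm3_smul hq hc h₀ h₁ h₂]
  have : conv3 (c * a₀) (c * a₁) (c * a₂) b₀ b₁ b₂ = c * conv3 a₀ a₁ a₂ b₀ b₁ b₂ := by
    unfold conv3
    simp only [mul_assoc, ← mul_max_of_nonneg _ _ hc]
    ring
  rw [this, mul_assoc]
  exact mul_le_mul_of_nonneg_left h hc

theorem Dom.smul_right {c : ℝ} (hq : 0 < q) (hc : 0 ≤ c) (h₀ : 0 ≤ b₀) (h₁ : 0 ≤ b₁) (h₂ : 0 ≤ b₂)
    (h : Dom q a₀ a₁ a₂ b₀ b₁ b₂) : Dom q a₀ a₁ a₂ (c * b₀) (c * b₁) (c * b₂) :=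
  (h.swap.smul_left hq hc h₀ h₁ h₂).swap

/-- With all other coordinates fixed, the inequality need only be checked at `a₀ = 0` and at the two
values of `a₀` where one of the maxima switches. -/
theorem dom_of_kinks_zero (hq : 1 ≤ q) (ha₀ : 0 ≤ a₀) (ha₁ : 0 ≤ a₁) (ha₂ : 0 ≤ a₂) (hb₀ : 0 ≤ b₀)
    (hb₁ : 0 ≤ b₁) (hb₂ : 0 ≤ b₂) (h : Dom q 0 a₁ a₂ b₀ b₁ b₂)
    (h' : Dom q (a₁ * b₀ / b₁) a₁ a₂ b₀ b₁ b₂)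
    (h'' : Dom q (max (a₁ * b₁) (a₂ * b₀) / b₂) a₁ a₂ b₀ b₁ b₂) : Dom q a₀ a₁ a₂ b₀ b₁ b₂ := by
  have hN := norm3_nonneg (q := q) hb₀ hb₁ hb₂
  refine le_of_le_at_kinks (M := fun s => norm3 q s a₁ a₂ * norm3 q b₀ b₁ b₂)
    (f := fun s => conv3 s a₁ a₂ b₀ b₁ b₂)
    (c₀ := max (a₁ * b₂) (a₂ * b₁) + a₂ * b₂) (c₁ := b₀) (p₁ := a₁ * b₀) (q₁ := b₁)
    (p₂ := max (a₁ * b₁) (a₂ * b₀)) (q₂ := b₂) (p₃ := 0) (q₃ := 0) ?_ (by positivity) hb₁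
    (by positivity) hb₂ le_rfl le_rfl ?_ ?_ h h' h'' (by simpa [Dom] using h) ha₀
  · simpa [mul_comm] using (norm3_convexOn hq ha₁ ha₂).smul hN
  · intro s δ hs hδ
    have h1 := norm3_add_first_le hq hs ha₁ ha₂ hδ
    have h2 := norm3_le_sum hq hb₀ hb₁ hb₂
    nlinarith [mul_le_mul_of_nonneg_right h1 hN, mul_le_mul_of_nonneg_left h2 hδ]
  · intro s
    simp only [conv3, zero_mul, max_self]
    rw [max_comm (s * b₁), max_comm (s * b₂), ← max_assoc, mul_comm s b₀, mul_comm s b₁,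
      mul_comm s b₂]
    ring

theorem dom_of_kinks_two (hq : 1 ≤ q) (ha₀ : 0 ≤ a₀) (ha₁ : 0 ≤ a₁) (ha₂ : 0 ≤ a₂) (hb₀ : 0 ≤ b₀)
    (hb₁ : 0 ≤ b₁) (hb₂ : 0 ≤ b₂) (h : Dom q a₀ a₁ 0 b₀ b₁ b₂)
    (h' : Dom q a₀ a₁ (a₁ * b₂ / b₁) b₀ b₁ b₂)
    (h'' : Dom q a₀ a₁ (max (a₁ * b₁) (a₀ * b₂) / b₀) b₀ b₁ b₂) : Dom q a₀ a₁ a₂ b₀ b₁ b₂ :=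
  (dom_of_kinks_zero hq ha₂ ha₁ ha₀ hb₂ hb₁ hb₀ h.reverse h'.reverse h''.reverse).reverse

theorem dom_of_kinks_one (hq : 1 ≤ q) (ha₀ : 0 ≤ a₀) (ha₁ : 0 ≤ a₁) (ha₂ : 0 ≤ a₂) (hb₀ : 0 ≤ b₀)
    (hb₁ : 0 ≤ b₁) (hb₂ : 0 ≤ b₂) (h : Dom q a₀ 0 a₂ b₀ b₁ b₂)
    (h' : Dom q a₀ (a₀ * b₁ / b₀) a₂ b₀ b₁ b₂) (h'' : Dom q a₀ (a₂ * b₁ / b₂) a₂ b₀ b₁ b₂)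
    (h''' : Dom q a₀ (max (a₀ * b₂) (a₂ * b₀) / b₁) a₂ b₀ b₁ b₂) : Dom q a₀ a₁ a₂ b₀ b₁ b₂ := by
  have hN := norm3_nonneg (q := q) hb₀ hb₁ hb₂
  refine le_of_le_at_kinks (M := fun s => norm3 q a₀ s a₂ * norm3 q b₀ b₁ b₂)
    (f := fun s => conv3 a₀ s a₂ b₀ b₁ b₂)
    (c₀ := a₀ * b₀ + a₂ * b₂) (c₁ := 0) (p₁ := a₀ * b₁) (q₁ := b₀) (p₂ := a₂ * b₁) (q₂ := b₂)
    (p₃ := max (a₀ * b₂) (a₂ * b₀)) (q₃ := b₁) ?_ (by positivity) hb₀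
    (by positivity) hb₂ (by positivity) hb₁ ?_ ?_ h h' h'' h''' ha₁
  · simp only [norm3_swap q _ a₀]
    simpa [mul_comm] using (norm3_convexOn hq ha₀ ha₂).smul hN
  · intro s δ hs hδ
    have h1 := norm3_add_first_le hq hs ha₀ ha₂ hδ
    have h2 := norm3_le_sum hq hb₀ hb₁ hb₂
    simp only [norm3_swap q _ a₀]
    nlinarith [mul_le_mul_of_nonneg_right h1 hN, mul_le_mul_of_nonneg_left h2 hδ]
  · intro s
    simp only [conv3, zero_mul]
    rw [max_comm (s * b₁), max_comm (s * b₂), mul_comm s b₀, mul_comm s b₁, mul_comm s b₂]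
    ring

/-! ### The special pairs at which the kinks meet -/

theorem norm3_sq {x y z : ℝ} (hx : 0 ≤ x) (hy : 0 ≤ y) (hz : 0 ≤ z) :
    norm3 q x y z ^ 2 = (x ^ q + y ^ q + z ^ q) ^ (2 / q) := by
  unfold norm3
  rw [← Real.rpow_natCast _ 2, ← Real.rpow_mul (by positivity)]
  congr 1; push_cast; ring

theorem norm3_geom_sq_le {t : ℝ} (hq0 : 4 / 3 ≤ q) (hq : q ≤ 11 / 8)
    (hlog : 2 * Real.log 3 = q * Real.log 5) (h0 : 0 ≤ t) :
    norm3 q 1 t (t ^ 2) ^ 2 ≤ 1 + t + t ^ 2 + t ^ 3 + t ^ 4 := by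
  rw [norm3_sq zero_le_one h0 (by positivity), Real.one_rpow]
  have e : (t ^ 2) ^ q = (t ^ q) ^ 2 := by
    rw [← Real.rpow_natCast, ← Real.rpow_natCast, ← Real.rpow_mul h0, ← Real.rpow_mul h0, mul_comm]
  rw [e]
  exact geom_le hq0 hq hlog h0

theorem norm3_one_zero_sq_le {t : ℝ} (hq0 : 4 / 3 ≤ q) (h0 : 0 ≤ t) :
    norm3 q 1 t 0 ^ 2 ≤ 1 + t + t ^ 2 := by
  rw [norm3_sq zero_le_one h0 le_rfl, Real.one_rpow, Real.zero_rpow (by linarith), add_zero]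
  exact two_point_le hq0 h0

theorem norm3_pair_sq_le {x y : ℝ} (hq0 : 4 / 3 ≤ q) (hx : 0 ≤ x) (hy : 0 ≤ y) :
    norm3 q x y 0 ^ 2 ≤ x ^ 2 + x * y + y ^ 2 := by
  have hq1 : 0 < q := by linarith
  rcases hx.eq_or_lt with rfl | hx
  · rw [norm3_swap, norm3_single hq1 hy]; nlinarith
  · have h := norm3_one_zero_sq_le hq0 (div_nonneg hy hx.le)
    have e := norm3_smul hq1 hx.le zero_le_one (div_nonneg hy hx.le) le_rfl
    rw [mul_one, mul_zero, mul_div_cancel₀ _ hx.ne'] at e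
    rw [e, mul_pow]
    calc x ^ 2 * norm3 q 1 (y / x) 0 ^ 2 ≤ x ^ 2 * (1 + y / x + (y / x) ^ 2) := by gcongr
      _ = _ := by field_simp

/-- The inequality for a geometric progression with itself; equality holds for `(1, 1, 1)`. -/
theorem norm3_geom_le {x g y : ℝ} (hq0 : 4 / 3 ≤ q) (hq : q ≤ 11 / 8)
    (hlog : 2 * Real.log 3 = q * Real.log 5) (hx : 0 < x) (hg : 0 ≤ g) (hxy : g ^ 2 = x * y) :
    norm3 q x g y ^ 2 ≤ x ^ 2 + g * (x + y) + g ^ 2 + y ^ 2 := by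
  have hq1 : 0 < q := by linarith
  have h := norm3_geom_sq_le hq0 hq hlog (div_nonneg hg hx.le)
  have e := norm3_smul hq1 hx.le zero_le_one (div_nonneg hg hx.le)
    (by positivity : 0 ≤ (g / x) ^ 2)
  have e2 : x * (g / x) ^ 2 = y := by field_simp; linarith
  rw [mul_one, e2, mul_div_cancel₀ _ hx.ne'] at e
  rw [e, mul_pow]
  calc x ^ 2 * norm3 q 1 (g / x) ((g / x) ^ 2) ^ 2
      ≤ x ^ 2 * (1 + g / x + (g / x) ^ 2 + (g / x) ^ 3 + (g / x) ^ 4) := by gcongr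
    _ = x ^ 2 + x * g + g ^ 2 + g * (x * (g / x) ^ 2) + (x * (g / x) ^ 2) ^ 2 := by field_simp
    _ = _ := by rw [e2]; ring

/-- `‖(x, s, y)‖_q²` for `s² ≤ x y`: it is convex in `s` while the bound is affine in `s`, and the
endpoints are a two-point vector and a geometric progression. -/
theorem norm3_sq_le_of_sq_le {x s y : ℝ} (hq0 : 4 / 3 ≤ q) (hq : q ≤ 11 / 8)
    (hlog : 2 * Real.log 3 = q * Real.log 5) (hx : 0 < x) (hs : 0 ≤ s) (hy : 0 ≤ y)
    (h : s ^ 2 ≤ x * y) :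
    norm3 q x s y ^ 2 ≤ x ^ 2 + s * (x + y) + x * y + y ^ 2 := by
  have hconv : ConvexOn ℝ (Set.Ici 0) (fun s => norm3 q x s y ^ 2) := by
    simp only [norm3_swap q _ x]
    exact (norm3_convexOn (by linarith) hx.le hy).pow
      (fun s hs => norm3_nonneg hs hx.le hy) 2
  have hg := Real.sq_sqrt (mul_nonneg hx.le hy)
  have h1 := norm3_geom_le hq0 hq hlog hx (Real.sqrt_nonneg _) hg
  have h2 := norm3_pair_sq_le hq0 hy hx.le
  rw [← norm3_reverse, norm3_swap] at h2
  have := le_affine_of_endpoints hconv (c₀ := x ^ 2 + x * y + y ^ 2) (c₁ := x + y) (u := 0)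
    (v := √(x * y)) (s := s) le_rfl ?_ ?_ hs (Real.le_sqrt_of_sq_le h)
  · linarith
  · linarith
  · linarith

/-- The derivative bound behind `norm3_sq_le_of_le_sq`. The rational bounds on `q` enter through
`2 ^ q ≤ 13 / 5` and `2 (2 / q - 1) ≤ 1`. -/
theorem one_add_rpow_add_rpow_le {x y : ℝ} (hq0 : 4 / 3 ≤ q) (hq : q ≤ 11 / 8) (hx : 0 ≤ x)
    (hy : 0 ≤ y) : (1 + (x ^ q + y ^ q)) ^ (2 / q - 1) ≤ 1 + (x + y) / 2 := by
  set m := (x + y) / 2 with hm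
  have hm0 : 0 ≤ m := by positivity
  have h1 : x ^ q + y ^ q ≤ (2 * m) ^ q := by
    have := Real.rpow_add_rpow_le_add hx hy (by linarith : 1 ≤ q)
    have e : 2 * m = x + y := by rw [hm]; ring
    rw [e]
    have h2 := Real.rpow_le_rpow (by positivity) this (by linarith : 0 ≤ q)
    rwa [← Real.rpow_mul (by positivity), one_div_mul_cancel (by linarith), Real.rpow_one] at h2
  have h2 : m ^ q ≤ (2 - q) * m + (q - 1) * m ^ 2 := by
    have := Real.geom_mean_le_arith_mean2_weighted (w₁ := 2 - q) (w₂ := q - 1) (p₁ := m)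
      (p₂ := m ^ 2) (by linarith) (by linarith) hm0 (by positivity) (by ring)
    rw [← Real.rpow_natCast m 2] at this ⊢
    rwa [← Real.rpow_mul hm0,
      ← Real.rpow_add_of_nonneg hm0 (by linarith) (by push_cast; linarith),
      show 2 - q + ((2 : ℕ) : ℝ) * (q - 1) = q by push_cast; ring] at this
  have h3 : (2 : ℝ) ^ q ≤ 13 / 5 := by
    calc (2 : ℝ) ^ q ≤ 2 ^ (11 / 8 : ℝ) := Real.rpow_le_rpow_of_exponent_le (by norm_num) hq
      _ ≤ 13 / 5 := by
        refine le_of_pow_le_pow_left₀ (n := 8) (by norm_num) (by norm_num) ?_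
        rw [← Real.rpow_natCast, ← Real.rpow_mul (by norm_num)]
        norm_num
  have h4 : x ^ q + y ^ q ≤ 2 * m + m ^ 2 := by
    refine h1.trans ?_
    rw [Real.mul_rpow (by norm_num) hm0]
    have h5 : (2 - q) * m + (q - 1) * m ^ 2 ≤ 2 / 3 * m + 3 / 8 * m ^ 2 := by
      nlinarith [sq_nonneg m]
    calc (2 : ℝ) ^ q * m ^ q ≤ 13 / 5 * (2 / 3 * m + 3 / 8 * m ^ 2) := by
          gcongr; exact h2.trans h5
      _ ≤ _ := by nlinarith [sq_nonneg m]
  have hexp : 0 ≤ 2 / q - 1 := by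
    rw [sub_nonneg, le_div_iff₀ (by linarith)]; linarith
  calc (1 + (x ^ q + y ^ q)) ^ (2 / q - 1) ≤ ((1 + m) ^ 2) ^ (2 / q - 1) := by
        gcongr; linarith
    _ = (1 + m) ^ (2 * (2 / q - 1)) := by
        rw [← Real.rpow_natCast, ← Real.rpow_mul (by positivity)]; norm_num
    _ ≤ (1 + m) ^ (1 : ℝ) := by
        apply Real.rpow_le_rpow_of_exponent_le (by linarith)
        have : 2 / q ≤ 3 / 2 := by rw [div_le_div_iff₀ (by linarith) (by norm_num)]; linarith
        linarith
    _ = 1 + m := Real.rpow_one _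

/-- `‖(x, s, y)‖_q²` for `s² ≥ x y`: the difference of the two sides is increasing in `s`, and the
case `s² = x y` is a geometric progression. -/
theorem norm3_sq_le_of_le_sq {x s y : ℝ} (hq0 : 4 / 3 ≤ q) (hq : q ≤ 11 / 8)
    (hlog : 2 * Real.log 3 = q * Real.log 5) (hx : 0 < x) (hs : 0 ≤ s) (hy : 0 < y)
    (h : x * y ≤ s ^ 2) :
    norm3 q x s y ^ 2 ≤ x ^ 2 + s * (x + y) + s ^ 2 + y ^ 2 := by
  have hq1 : 0 < q := by linarith
  set g := √(x * y) with hgdef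
  have hg0 : 0 < g := Real.sqrt_pos.2 (by positivity)
  have hgs : g ≤ s := Real.sqrt_le_left hs |>.2 h
  let H : ℝ → ℝ := fun s => s * (x + y) + s ^ 2 - (s ^ q + (x ^ q + y ^ q)) ^ (2 / q)
  have hH : ∀ s, 0 < s → HasDerivAt H ((x + y) + 2 * s -
      (q * s ^ (q - 1)) * (2 / q) * (s ^ q + (x ^ q + y ^ q)) ^ (2 / q - 1)) s := by
    intro s hs
    have h1 : HasDerivAt (fun s => s ^ q + (x ^ q + y ^ q)) (q * s ^ (q - 1)) s :=
      (Real.hasDerivAt_rpow_const (Or.inl hs.ne')).add_const _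
    have h2 := h1.rpow_const (p := 2 / q) (Or.inl (by positivity))
    have h3 := (((hasDerivAt_id s).mul_const (x + y)).add (hasDerivAt_pow 2 s)).sub h2
    exact h3.congr_deriv (by simp)
  have hmono : MonotoneOn H (Set.Ici g) := by
    apply monotoneOn_of_deriv_nonneg (convex_Ici _)
    · intro t ht; exact (hH t (hg0.trans_le ht)).continuousAt.continuousWithinAt
    · intro t ht; rw [interior_Ici] at ht
      exact (hH t (hg0.trans ht)).differentiableAt.differentiableWithinAt
    · intro t ht; rw [interior_Ici] at ht
      have ht : 0 < t := hg0.trans ht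
      rw [(hH t ht).deriv]
      have h1 := one_add_rpow_add_rpow_le hq0 hq (div_nonneg hx.le ht.le) (div_nonneg hy.le ht.le)
      have e1 : t ^ q + (x ^ q + y ^ q) = t ^ q * (1 + ((x / t) ^ q + (y / t) ^ q)) := by
        rw [Real.div_rpow hx.le ht.le, Real.div_rpow hy.le ht.le]; field_simp
      have e2 : t ^ (q - 1) * (t ^ q) ^ (2 / q - 1) = t := by
        rw [← Real.rpow_mul ht.le, ← Real.rpow_add ht,
          show q - 1 + q * (2 / q - 1) = 1 by field_simp; ring, Real.rpow_one]
      rw [e1, Real.mul_rpow (by positivity) (by positivity)]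
      have e3 : q * t ^ (q - 1) * (2 / q) * ((t ^ q) ^ (2 / q - 1) *
          (1 + ((x / t) ^ q + (y / t) ^ q)) ^ (2 / q - 1)) =
          2 * ((t ^ (q - 1) * (t ^ q) ^ (2 / q - 1)) *
            (1 + ((x / t) ^ q + (y / t) ^ q)) ^ (2 / q - 1)) := by
        field_simp
      rw [e3, e2]
      have h2 := mul_le_mul_of_nonneg_left h1 ht.le
      have e4 : t * (1 + (x / t + y / t) / 2) = t + (x + y) / 2 := by field_simp
      rw [e4] at h2
      linarith
  have h1 := hmono (Set.mem_Ici.2 le_rfl) (Set.mem_Ici.2 hgs) hgs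
  have h2 := norm3_geom_le hq0 hq hlog hx hg0.le (Real.sq_sqrt (mul_nonneg hx.le hy.le))
  rw [← norm3_swap, norm3_sq hg0.le hx.le hy.le, add_assoc] at h2
  rw [← norm3_swap, norm3_sq hs hx.le hy.le, add_assoc]
  simp only [H] at h1
  linarith

/-- The inequality for `(x, s, y)` and its reversed inverse, which is proportional to `(x, w, y)`
with `s w = x y`. As `w` grows with `s w` fixed, the right-hand side is affine and the left-hand side
grows at most as fast, so this reduces to the geometric progression `s = w`. -/
theorem norm3_mul_le_of_mul_eq {x s w y : ℝ} (hq0 : 4 / 3 ≤ q) (hq : q ≤ 11 / 8)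
    (hlog : 2 * Real.log 3 = q * Real.log 5) (hx : 0 < x) (hs : 0 ≤ s) (hy : 0 < y) (hsw : s ≤ w)
    (h : s * w = x * y) :
    norm3 q x s y * norm3 q x w y ≤ x ^ 2 + x * y + w * (x + y) + y ^ 2 := by
  have hq1 : 0 < q := by linarith
  have hw : 0 ≤ w := hs.trans hsw
  set E := norm3 q x y 0 with hE
  have hE0 : 0 ≤ E := norm3_nonneg hx.le hy.le le_rfl
  have hEq : E ^ q = x ^ q + y ^ q := by
    rw [hE, norm3, Real.zero_rpow hq1.ne', add_zero, ← Real.rpow_mul (by positivity),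
      one_div_mul_cancel hq1.ne', Real.rpow_one]
  set K := ((x ^ q) ^ 2 + (y ^ q) ^ 2 + 3 * (x ^ q * y ^ q)) ^ (1 / q) with hK
  have hK0 : 0 ≤ K := by positivity
  have hKq : K ^ q = (x ^ q) ^ 2 + (y ^ q) ^ 2 + 3 * (x ^ q * y ^ q) := by
    rw [hK, ← Real.rpow_mul (by positivity), one_div_mul_cancel hq1.ne', Real.rpow_one]
  -- the product of the two norms is the norm of a vector which in which
  -- only the first two entries depend on `s` and `w`
  have key : ∀ s w, 0 ≤ s → 0 ≤ w → s * w = x * y →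
      norm3 q x s y * norm3 q x w y = norm3 q (E * w) (E * s) K := by
    intro s w hs hw h
    have hq' : s ^ q * w ^ q = x ^ q * y ^ q := by
      rw [← Real.mul_rpow hs hw, h, Real.mul_rpow hx.le hy.le]
    unfold norm3
    rw [← Real.mul_rpow (by positivity) (by positivity), Real.mul_rpow hE0 hs,
      Real.mul_rpow hE0 hw, hEq, hKq]
    congr 1
    linear_combination hq'
  set g := √(x * y) with hgdef
  have hg := Real.sq_sqrt (mul_nonneg hx.le hy.le)
  rw [← hgdef] at hg
  have hg0 : 0 ≤ g := Real.sqrt_nonneg _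
  have hgg := norm3_geom_le hq0 hq hlog hx hg0 hg
  have hsg : s ≤ g := Real.le_sqrt_of_sq_le (by nlinarith)
  have hgw : g ≤ w := by
    rw [hgdef, Real.sqrt_le_left hw]; nlinarith
  rw [pow_two (norm3 q x g y), key g g hg0 hg0 (by linarith)] at hgg
  rw [key s w hs hw h]
  calc norm3 q (E * w) (E * s) K ≤ norm3 q (E * g + E * (w - g)) (E * g) K := by
        apply norm3_mono hq1 (by positivity) (by positivity) hK0 (by linarith) _ le_rfl
        gcongr
    _ ≤ norm3 q (E * g) (E * g) K + E * (w - g) :=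
        norm3_add_first_le (by linarith) (by positivity) (by positivity) hK0
          (mul_nonneg hE0 (by linarith))
    _ ≤ norm3 q (E * g) (E * g) K + (x + y + 0) * (w - g) := by
        gcongr
        exact norm3_le_sum (by linarith) hx.le hy.le le_rfl
    _ ≤ _ := by nlinarith

theorem dom_single_zero {c : ℝ} (hq : 1 ≤ q) (hc : 0 ≤ c) (hb₀ : 0 ≤ b₀) (hb₁ : 0 ≤ b₁)
    (hb₂ : 0 ≤ b₂) : Dom q c 0 0 b₀ b₁ b₂ := by
  have h1 : 0 ≤ c * b₁ := by positivity
  have h2 : 0 ≤ c * b₂ := by positivity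
  simp only [Dom, conv3, norm3_single (by linarith : 0 < q) hc, zero_mul, max_self,
    max_eq_left h1, max_eq_left h2, max_eq_right h2]
  linarith [mul_le_mul_of_nonneg_left (norm3_le_sum hq hb₀ hb₁ hb₂) hc]

theorem dom_single_one {c : ℝ} (hq : 1 ≤ q) (hc : 0 ≤ c) (hb₀ : 0 ≤ b₀) (hb₁ : 0 ≤ b₁)
    (hb₂ : 0 ≤ b₂) : Dom q 0 c 0 b₀ b₁ b₂ := by
  have h0 : 0 ≤ c * b₀ := by positivity
  have h1 : 0 ≤ c * b₁ := by positivity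
  have h2 : 0 ≤ c * b₂ := by positivity
  simp only [Dom, conv3, ← norm3_swap q 0 c, norm3_single (by linarith : 0 < q) hc, zero_mul,
    max_self, max_eq_left h1, max_eq_left h2, max_eq_right h0]
  linarith [mul_le_mul_of_nonneg_left (norm3_le_sum hq hb₀ hb₁ hb₂) hc]

theorem dom_single_two {c : ℝ} (hq : 1 ≤ q) (hc : 0 ≤ c) (hb₀ : 0 ≤ b₀) (hb₁ : 0 ≤ b₁)
    (hb₂ : 0 ≤ b₂) : Dom q 0 0 c b₀ b₁ b₂ :=
  (dom_single_zero hq hc hb₂ hb₁ hb₀).reverse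

theorem le_conv3_self {x s y : ℝ} :
    x ^ 2 + s * (x + y) + max (s ^ 2) (x * y) + y ^ 2 ≤ conv3 x s y x s y := by
  have h1 := le_max_left (x * s) (s * x)
  have h2 : max (s ^ 2) (x * y) ≤ max (s * s) (max (x * y) (y * x)) := by
    rw [pow_two]; exact max_le_max le_rfl (le_max_left _ _)
  have h3 := le_max_left (s * y) (y * s)
  unfold conv3
  linarith

theorem dom_self {x s y : ℝ} (hq0 : 4 / 3 ≤ q) (hq : q ≤ 11 / 8)
    (hlog : 2 * Real.log 3 = q * Real.log 5) (hx : 0 < x) (hs : 0 ≤ s) (hy : 0 < y) :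
    Dom q x s y x s y := by
  unfold Dom
  refine le_trans ?_ le_conv3_self
  rw [← pow_two]
  rcases le_total (x * y) (s ^ 2) with h | h
  · rw [max_eq_left h]; exact norm3_sq_le_of_le_sq hq0 hq hlog hx hs hy h
  · rw [max_eq_right h]; exact norm3_sq_le_of_sq_le hq0 hq hlog hx hs hy.le h

theorem dom_of_mul_eq {x s w y : ℝ} (hq0 : 4 / 3 ≤ q) (hq : q ≤ 11 / 8)
    (hlog : 2 * Real.log 3 = q * Real.log 5) (hx : 0 < x) (hs : 0 ≤ s) (hw : 0 ≤ w) (hy : 0 < y)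
    (h : s * w = x * y) : Dom q x s y x w y := by
  wlog hsw : s ≤ w generalizing s w
  · exact (this hw hs (by linarith) (le_of_not_ge hsw)).swap
  refine (norm3_mul_le_of_mul_eq hq0 hq hlog hx hs hy hsw h).trans ?_
  have h1 := le_max_left (x * w) (s * x)
  have h2 := le_max_left (s * w) (max (x * y) (y * x))
  have h3 := le_max_right (s * y) (y * w)
  unfold conv3
  linarith

theorem dom_pair_self {x s : ℝ} (hq0 : 4 / 3 ≤ q) (hx : 0 ≤ x) (hs : 0 ≤ s) :
    Dom q x s 0 x s 0 := by
  unfold Dom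
  refine le_trans ?_ le_conv3_self
  rw [← pow_two, mul_zero, max_eq_left (by positivity)]
  linarith [norm3_pair_sq_le hq0 hx hs]

theorem dom_pair_shift {x s : ℝ} (hq0 : 4 / 3 ≤ q) (hx : 0 ≤ x) (hs : 0 ≤ s) :
    Dom q x s 0 0 x s := by
  have h := norm3_pair_sq_le hq0 hx hs
  have e : norm3 q 0 x s = norm3 q x s 0 := by
    unfold norm3; congr 1; ring
  have hxs : 0 ≤ x * s := by positivity
  have hx2 : 0 ≤ x * x := by positivity
  simp only [Dom, conv3, e, mul_zero, zero_mul, max_eq_left hxs, max_eq_left hx2, max_self,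
    max_eq_left (mul_nonneg hs hs), mul_comm s x]
  rw [← pow_two]
  linarith

theorem dom_ends_self {x y : ℝ} (hq0 : 4 / 3 ≤ q) (hx : 0 ≤ x) (hy : 0 ≤ y) :
    Dom q x 0 y x 0 y := by
  have h := norm3_pair_sq_le hq0 hy hx
  rw [← norm3_reverse, norm3_swap] at h
  unfold Dom
  refine le_trans ?_ le_conv3_self
  have hxy : 0 ≤ x * y := by positivity
  rw [← pow_two, max_eq_right (by simpa using hxy)]
  linarith

/-- `((1, t, 0), (1, t, t²))`: since `(1 + t + t²)(1 + t + t² + t³ + t⁴) ≤ (1 + t + t² + t³)²`, this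
is a consequence of the cases of two equal pairs and of two equal geometric progressions. -/
theorem dom_pair_geom {t : ℝ} (hq0 : 4 / 3 ≤ q) (hq : q ≤ 11 / 8)
    (hlog : 2 * Real.log 3 = q * Real.log 5) (h0 : 0 ≤ t) :
    Dom q 1 t 0 1 t (t ^ 2) := by
  have h1 := norm3_geom_sq_le hq0 hq hlog h0
  have h2 := norm3_one_zero_sq_le hq0 h0
  have h3 : norm3 q 1 t 0 * norm3 q 1 t (t ^ 2) ≤ 1 + t + t ^ 2 + t ^ 3 := by
    refine le_of_sq_le_sq ?_ (by positivity)
    calc (norm3 q 1 t 0 * norm3 q 1 t (t ^ 2)) ^ 2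
        = norm3 q 1 t 0 ^ 2 * norm3 q 1 t (t ^ 2) ^ 2 := by ring
      _ ≤ (1 + t + t ^ 2) * (1 + t + t ^ 2 + t ^ 3 + t ^ 4) := by gcongr
      _ ≤ _ := by nlinarith [pow_nonneg h0 3]
  have h4 := le_max_left (1 * t) (t * 1)
  have h5 := le_max_left (t * t) (max (1 * t ^ 2) (0 * 1))
  have h6 := le_max_left (t * t ^ 2) (0 * t)
  unfold Dom conv3
  linarith

/-! ### The one-dimensional inequality -/

theorem dom_ends (hq0 : 4 / 3 ≤ q) (ha₀ : 0 ≤ a₀) (ha₂ : 0 ≤ a₂) (hb₀ : 0 ≤ b₀) (hb₁ : 0 ≤ b₁)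
    (hb₂ : 0 ≤ b₂) : Dom q a₀ 0 a₂ b₀ b₁ b₂ := by
  have hq1 : 1 ≤ q := by linarith
  rcases ha₂.eq_or_lt with rfl | ha₂'
  · exact dom_single_zero hq1 ha₀ hb₀ hb₁ hb₂
  have h0 : Dom q 0 0 b₂ a₀ 0 a₂ := dom_single_two hq1 hb₂ ha₀ le_rfl ha₂
  have h : Dom q b₀ 0 b₂ a₀ 0 a₂ := by
    refine dom_of_kinks_zero hq1 hb₀ le_rfl hb₂ ha₀ le_rfl ha₂ h0 (by simpa using h0) ?_
    have := (dom_ends_self hq0 ha₀ ha₂).smul_left (c := b₂ / a₂) (by linarith) (by positivity)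
      ha₀ le_rfl ha₂
    convert! this using 1
    · rw [mul_zero, max_eq_right (by positivity)]; field_simp
    · simp
    · field_simp
  refine (dom_of_kinks_one hq1 hb₀ hb₁ hb₂ ha₀ le_rfl ha₂ h ?_ ?_ ?_).swap <;> simpa using h

/-- The kinks for a pair lead to shifts of the same pair and to a geometric progression. -/
theorem dom_pair (hq0 : 4 / 3 ≤ q) (hq : q ≤ 11 / 8)
    (hlog : 2 * Real.log 3 = q * Real.log 5) (ha₀ : 0 ≤ a₀) (ha₁ : 0 ≤ a₁) (hb₀ : 0 ≤ b₀)
    (hb₁ : 0 ≤ b₁) (hb₂ : 0 ≤ b₂) : Dom q a₀ a₁ 0 b₀ b₁ b₂ := by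
  have hq1 : 1 ≤ q := by linarith
  have hq00 : 0 < q := by linarith
  rcases ha₀.eq_or_lt with rfl | ha₀'
  · exact dom_single_one hq1 ha₁ hb₀ hb₁ hb₂
  rcases ha₁.eq_or_lt with rfl | ha₁'
  · exact dom_single_zero hq1 ha₀ hb₀ hb₁ hb₂
  have h00 : Dom q 0 b₁ 0 a₀ a₁ 0 := dom_single_one hq1 hb₁ ha₀ ha₁ le_rfl
  have h01 : Dom q 0 b₁ (b₁ * a₁ / a₀) a₀ a₁ 0 := by
    have := (dom_pair_shift hq0 ha₀ ha₁).swap.smul_left (c := b₁ / a₀) hq00 (by positivity) le_rfl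
      ha₀ ha₁
    convert! this using 1
    · simp
    · field_simp
    · field_simp
  have h10 : Dom q (b₁ * a₀ / a₁) b₁ 0 a₀ a₁ 0 := by
    have := (dom_pair_self hq0 ha₀ ha₁).smul_left (c := b₁ / a₁) hq00 (by positivity) ha₀ ha₁ le_rfl
    convert! this using 1
    · field_simp
    · field_simp
    · simp
  have h11 : Dom q (b₁ * a₀ / a₁) b₁ (b₁ * a₁ / a₀) a₀ a₁ 0 := by
    have ht : 0 ≤ a₁ / a₀ := by positivity
    have := (((dom_pair_geom hq0 hq hlog ht).smul_left (c := a₀) hq00 ha₀ zero_le_one ht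
      le_rfl).swap).smul_left (c := b₁ * a₀ / a₁) hq00 (by positivity) zero_le_one ht (by positivity)
    convert! this using 1
    · simp
    · field_simp
    · field_simp
    · simp
    · field_simp
    · simp
  have h0 : Dom q 0 b₁ b₂ a₀ a₁ 0 :=
    dom_of_kinks_two hq1 le_rfl hb₁ hb₂ ha₀ ha₁ le_rfl h00 (by simpa using h00)
      (by rwa [zero_mul, max_eq_left (by positivity)])
  have h1 : Dom q (b₁ * a₀ / a₁) b₁ b₂ a₀ a₁ 0 :=
    dom_of_kinks_two hq1 (by positivity) hb₁ hb₂ ha₀ ha₁ le_rfl h10 (by simpa using h10)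
      (by rwa [mul_zero, max_eq_left (by positivity)])
  exact (dom_of_kinks_zero hq1 hb₀ hb₁ hb₂ ha₀ ha₁ le_rfl h0 h1 (by simpa using h0)).swap

/-- For a geometric progression all kinks coincide, at the progression itself. -/
theorem dom_geom {t : ℝ} (hq0 : 4 / 3 ≤ q) (hq : q ≤ 11 / 8)
    (hlog : 2 * Real.log 3 = q * Real.log 5) (ht : 0 < t) (hb₀ : 0 ≤ b₀)
    (hb₁ : 0 ≤ b₁) (hb₂ : 0 ≤ b₂) : Dom q b₀ b₁ b₂ 1 t (t ^ 2) := by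
  have hq1 : 1 ≤ q := by linarith
  have hq00 : 0 < q := by linarith
  have ht2 : 0 < t ^ 2 := by positivity
  have hself : ∀ c, 0 ≤ c → Dom q (c * 1) (c * t) (c * t ^ 2) 1 t (t ^ 2) := fun c hc =>
    (dom_self hq0 hq hlog zero_lt_one ht.le ht2).smul_left hq00 hc zero_le_one ht.le ht2.le
  have h0 : Dom q 0 b₁ b₂ 1 t (t ^ 2) :=
    (dom_pair hq0 hq hlog hb₂ hb₁ ht2.le ht.le zero_le_one).reverse
  have hA : Dom q (b₁ * 1 / t) b₁ b₂ 1 t (t ^ 2) := by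
    have h := hself (b₁ / t) (by positivity)
    refine dom_of_kinks_two hq1 (by positivity) hb₁ hb₂ zero_le_one ht.le ht2.le
      (dom_pair hq0 hq hlog (by positivity) hb₁ zero_le_one ht.le ht2.le) ?_ ?_
    · convert! h using 1 <;> field_simp
    · convert! h using 1
      · field_simp
      · field_simp
      · rw [max_eq_left (by field_simp; rfl)]; field_simp
  refine dom_of_kinks_zero hq1 hb₀ hb₁ hb₂ zero_le_one ht.le ht2.le h0 hA ?_
  rcases le_total (b₂ * 1) (b₁ * t) with hle | hle
  · rw [max_eq_left hle]
    convert! hA using 1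
    field_simp
  · rw [max_eq_right hle]
    have h := hself (b₂ / t ^ 2) (by positivity)
    refine dom_of_kinks_one hq1 (by positivity) hb₁ hb₂ zero_le_one ht.le ht2.le
      (dom_ends hq0 (by positivity) hb₂ zero_le_one ht.le ht2.le) ?_ ?_ ?_
    · convert! h using 1 <;> field_simp
    · convert! h using 1 <;> field_simp
    · convert! h using 1
      · field_simp
      · rw [max_eq_left (by field_simp; rfl)]; field_simp
      · field_simp

/-- The inequality with both middle coordinates normalised to `1`. The kinks lead to four kinds of
first vector: `(x, 1, y)`, its reversed inverse, geometric progressions, and vectors with a zero. -/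
theorem dom_of_middle_one {x y : ℝ} (hq0 : 4 / 3 ≤ q) (hq : q ≤ 11 / 8)
    (hlog : 2 * Real.log 3 = q * Real.log 5) (ha₀ : 0 ≤ a₀) (ha₂ : 0 ≤ a₂)
    (hx : 0 < x) (hy : 0 < y) : Dom q a₀ 1 a₂ x 1 y := by
  have hq1 : 1 ≤ q := by linarith
  have hq00 : 0 < q := by linarith
  have hself := dom_self hq0 hq hlog hx zero_le_one hy
  have hinv : Dom q x (x * y) y x 1 y :=
    dom_of_mul_eq hq0 hq hlog hx (by positivity) zero_le_one hy (mul_one _)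
  have hz0 : ∀ a₂, 0 ≤ a₂ → Dom q 0 1 a₂ x 1 y := fun a₂ h =>
    (dom_pair hq0 hq hlog h zero_le_one hy.le zero_le_one hx.le).reverse
  have hz2 : ∀ a₀, 0 ≤ a₀ → Dom q a₀ 1 0 x 1 y := fun a₀ h =>
    dom_pair hq0 hq hlog h zero_le_one hx.le zero_le_one hy.le
  have hgeom : ∀ t, 0 < t → Dom q (1 / t) 1 t x 1 y := by
    intro t ht
    have := (dom_geom hq0 hq hlog ht hx.le zero_le_one hy.le).swap.smul_left (c := 1 / t) hq00
      (by positivity) zero_le_one ht.le (by positivity)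
    convert! this using 1 <;> field_simp
  -- `a₀ = x`: the kinks in `a₂` are `y` and `1 / x`
  have hA : Dom q x 1 a₂ x 1 y := by
    refine dom_of_kinks_two hq1 hx.le zero_le_one ha₂ hx.le zero_le_one hy.le (hz2 x hx.le)
      (by simpa using hself) ?_
    rcases le_total (1 * 1) (x * y) with h | h
    · rw [max_eq_right h, mul_div_cancel_left₀ _ hx.ne']; exact hself
    · rw [max_eq_left h]
      convert! hgeom (1 / x) (by positivity) using 1
      · field_simp
      · norm_num
  refine dom_of_kinks_zero hq1 ha₀ zero_le_one ha₂ hx.le zero_le_one hy.le (hz0 a₂ ha₂)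
    (by simpa using hA) ?_
  rcases le_total (a₂ * x) (1 * 1) with h | h
  · -- `a₀ = 1 / y`: the kinks in `a₂` are again `y` and `1 / x`
    rw [max_eq_left h, one_mul]
    refine dom_of_kinks_two hq1 (by positivity) zero_le_one ha₂ hx.le zero_le_one hy.le
      (hz2 _ (by positivity)) ?_ ?_
    · convert! hgeom y hy using 1
      simp
    · rw [max_eq_left (by rw [one_div_mul_cancel hy.ne']; norm_num)]
      have := hinv.smul_left (c := 1 / (x * y)) hq00 (by positivity) hx.le (by positivity) hy.le
      convert! this using 1 <;> field_simp
  · -- `a₀ : a₂ = x : y`: move the middle coordinate instead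
    rw [max_eq_right h]
    have hs : 0 < a₂ := by
      rcases ha₂.eq_or_lt with rfl | h'
      · rw [zero_mul] at h; norm_num at h
      · exact h'
    have hm : Dom q x (y / a₂) y x 1 y := by
      refine dom_of_kinks_one hq1 hx.le (by positivity) hy.le hx.le zero_le_one hy.le
        (dom_ends hq0 hx.le hy.le hx.le zero_le_one hy.le) ?_ ?_ ?_
      · simpa [hx.ne'] using hself
      · simpa [hy.ne'] using hself
      · simpa [mul_comm y x] using hinv
    have := hm.smul_left (c := a₂ / y) hq00 (by positivity) hx.le (by positivity) hy.le
    convert! this using 1 <;> field_simp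

/-- The one-dimensional inequality, sharp for `a = b = (1, 1, 1)`. -/
theorem dom (hq0 : 4 / 3 ≤ q) (hq : q ≤ 11 / 8) (hlog : 2 * Real.log 3 = q * Real.log 5)
    (ha₀ : 0 ≤ a₀) (ha₁ : 0 ≤ a₁) (ha₂ : 0 ≤ a₂) (hb₀ : 0 ≤ b₀) (hb₁ : 0 ≤ b₁) (hb₂ : 0 ≤ b₂) :
    Dom q a₀ a₁ a₂ b₀ b₁ b₂ := by
  have hq00 : 0 < q := by linarith
  rcases ha₁.eq_or_lt with rfl | ha₁
  · exact dom_ends hq0 ha₀ ha₂ hb₀ hb₁ hb₂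
  rcases hb₁.eq_or_lt with rfl | hb₁
  · exact (dom_ends hq0 hb₀ hb₂ ha₀ ha₁.le ha₂).swap
  rcases hb₀.eq_or_lt with rfl | hb₀
  · exact (dom_pair hq0 hq hlog hb₂ hb₁.le ha₂ ha₁.le ha₀).reverse.swap
  rcases hb₂.eq_or_lt with rfl | hb₂
  · exact (dom_pair hq0 hq hlog hb₀.le hb₁.le ha₀ ha₁.le ha₂).swap
  have h := dom_of_middle_one hq0 hq hlog (div_nonneg ha₀ ha₁.le) (div_nonneg ha₂ ha₁.le)
    (div_pos hb₀ hb₁) (div_pos hb₂ hb₁)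
  have h' := (h.smul_left hq00 ha₁.le (div_nonneg ha₀ ha₁.le) zero_le_one
    (div_nonneg ha₂ ha₁.le)).smul_right hq00 hb₁.le (div_pos hb₀ hb₁).le zero_le_one
    (div_pos hb₂ hb₁).le
  simpa [mul_div_cancel₀ _ ha₁.ne', mul_div_cancel₀ _ hb₁.ne'] using h'

end OneDimensional

/-! ### Tensorization -/

/-- Addition of digits `{0, 1, 2} × {0, 1, 2} → {0, …, 4}`, without wrap-around. -/
def digitAdd (i j : Fin 3) : Fin 5 := ⟨i + j, by omega⟩

theorem sum_cons {n d : ℕ} (F : (Fin (d + 1) → Fin n) → ℝ) :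
    ∑ x, F x = ∑ i, ∑ x : Fin d → Fin n, F (Fin.cons i x) := by
  rw [← (Fin.consEquiv (fun _ : Fin (d + 1) => Fin n)).sum_comp, Fintype.sum_prod_type]
  rfl

/-- The inequality on the discrete cube, by induction on the dimension: splitting off one coordinate
and applying the induction hypothesis to the slices leaves the one-dimensional inequality for the
vectors of norms of slices. -/
theorem lp_mul_lp_le_sum {q : ℝ} (hq0 : 4 / 3 ≤ q) (hq : q ≤ 11 / 8)
    (hlog : 2 * Real.log 3 = q * Real.log 5) (d : ℕ) :
    ∀ (F G : (Fin d → Fin 3) → ℝ) (H : (Fin d → Fin 5) → ℝ), (∀ x, 0 ≤ F x) → (∀ x, 0 ≤ G x) →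
      (∀ x y, F x * G y ≤ H (fun i => digitAdd (x i) (y i))) →
      (∑ x, F x ^ q) ^ (1 / q) * (∑ x, G x ^ q) ^ (1 / q) ≤ ∑ z, H z := by
  have hq00 : 0 < q := by linarith
  induction d with
  | zero =>
    intro F G H hF hG h
    have := h default default
    simp only [Fintype.sum_unique]
    rw [← Real.rpow_mul (hF _), ← Real.rpow_mul (hG _), mul_one_div_cancel hq00.ne', Real.rpow_one,
      Real.rpow_one]
    convert! this using 2 <;> exact congrArg _ (Subsingleton.elim _ _)
  | succ d ih =>
    intro F G H hF hG h
    let a : Fin 3 → ℝ := fun i => (∑ x : Fin d → Fin 3, F (Fin.cons i x) ^ q) ^ (1 / q)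
    let b : Fin 3 → ℝ := fun i => (∑ x : Fin d → Fin 3, G (Fin.cons i x) ^ q) ^ (1 / q)
    let S : Fin 5 → ℝ := fun k => ∑ z : Fin d → Fin 5, H (Fin.cons k z)
    have hsum : ∀ F : (Fin (d + 1) → Fin 3) → ℝ, (∀ x, 0 ≤ F x) → ∀ i,
        0 ≤ ∑ x : Fin d → Fin 3, F (Fin.cons i x) ^ q :=
      fun F hF i => Finset.sum_nonneg fun x _ => Real.rpow_nonneg (hF _) _
    have ha : ∀ i, 0 ≤ a i := fun i => Real.rpow_nonneg (hsum F hF i) _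
    have hb : ∀ i, 0 ≤ b i := fun i => Real.rpow_nonneg (hsum G hG i) _
    have hab : ∀ i j, a i * b j ≤ S (digitAdd i j) := by
      intro i j
      refine ih _ _ _ (fun x => hF _) (fun x => hG _) fun x y => (h _ _).trans_eq ?_
      congr 1
      funext k
      refine Fin.cases ?_ (fun k => ?_) k <;> simp
    have hN : ∀ F : (Fin (d + 1) → Fin 3) → ℝ, (∀ x, 0 ≤ F x) → (∑ x, F x ^ q) ^ (1 / q) =
        norm3 q ((∑ x : Fin d → Fin 3, F (Fin.cons 0 x) ^ q) ^ (1 / q))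
          ((∑ x : Fin d → Fin 3, F (Fin.cons 1 x) ^ q) ^ (1 / q))
          ((∑ x : Fin d → Fin 3, F (Fin.cons 2 x) ^ q) ^ (1 / q)) := by
      intro F hF
      have hc : ∀ s : ℝ, 0 ≤ s → (s ^ (1 / q)) ^ q = s := fun s hs => by
        rw [← Real.rpow_mul hs, one_div_mul_cancel hq00.ne', Real.rpow_one]
      rw [norm3, hc _ (hsum F hF 0), hc _ (hsum F hF 1), hc _ (hsum F hF 2), sum_cons,
        Fin.sum_univ_three]
    rw [hN F hF, hN G hG]
    refine (dom hq0 hq hlog (ha 0) (ha 1) (ha 2) (hb 0) (hb 1) (hb 2)).trans ?_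
    rw [sum_cons, Fin.sum_univ_five]
    exact add_le_add (add_le_add (add_le_add (add_le_add (hab 0 0)
      (max_le (hab 0 1) (hab 1 0))) (max_le (hab 1 1) (max_le (hab 0 2) (hab 2 0))))
      (max_le (hab 1 2) (hab 2 1))) (hab 2 2)

/-! ### Functions on the lattice -/

/-- The lattice point with the given digits. -/
def ofDigits {n d : ℕ} (x : Fin d → Fin n) : Fin d → ℤ := fun i => ((x i : ℕ) : ℤ)

theorem ofDigits_injective {n d : ℕ} : Function.Injective (ofDigits (n := n) (d := d)) := by
  intro x y h
  funext i
  have := congrFun h i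
  simp only [ofDigits, Nat.cast_inj] at this
  exact Fin.ext this

theorem ofDigits_add {d : ℕ} (x y : Fin d → Fin 3) :
    ofDigits x + ofDigits y = ofDigits (fun i => digitAdd (x i) (y i)) := by
  funext i; simp [ofDigits, digitAdd]

theorem range_ofDigits_three (d : ℕ) : Set.range (ofDigits (n := 3) (d := d)) = cube d := by
  ext z
  constructor
  · rintro ⟨x, rfl⟩ i
    simp only [ofDigits]
    have := (x i).isLt
    omega
  · intro hz
    refine ⟨fun i => ⟨(z i).toNat, ?_⟩, ?_⟩
    · rcases hz i with h | h | h <;> simp [h]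
    · funext i
      rcases hz i with h | h | h <;> simp [ofDigits, h]

theorem cube_finite (d : ℕ) : (cube d).Finite := by
  rw [← range_ofDigits_three]; exact Set.finite_range _

theorem add_mem_range_ofDigits {d : ℕ} {x y : Fin d → ℤ} (hx : x ∈ cube d) (hy : y ∈ cube d) :
    x + y ∈ Set.range (ofDigits (n := 5) (d := d)) := by
  rw [← range_ofDigits_three] at hx hy
  obtain ⟨x, rfl⟩ := hx
  obtain ⟨y, rfl⟩ := hy
  exact ⟨_, (ofDigits_add x y).symm⟩

theorem ellNorm_eq_sum {n d : ℕ} {r : ℝ} (hr : 0 < r) {f : (Fin d → ℤ) → ℝ} (hf : ∀ x, 0 ≤ f x)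
    (hs : Function.support f ⊆ Set.range (ofDigits (n := n) (d := d))) :
    ellNorm r f = (∑ x : Fin d → Fin n, f (ofDigits x) ^ r) ^ (1 / r) := by
  unfold ellNorm
  rw [← ofDigits_injective.tsum_eq, tsum_fintype]
  · simp only [abs_of_nonneg (hf _)]
    congr!
  · intro x hx
    apply hs
    intro h
    apply hx
    simp [h, Real.zero_rpow hr.ne']

theorem le_supConv {d : ℕ} {f g : (Fin d → ℤ) → ℝ} (hf : Function.support f ⊆ cube d)
    (x y : Fin d → ℤ) : f x * g y ≤ supConv f g (x + y) := by
  have hb : BddAbove (Set.range fun u => f u * g (x + y - u)) := by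
    refine Set.Finite.bddAbove (Set.Finite.subset
      (((cube_finite d).image fun u => f u * g (x + y - u)).insert 0) ?_)
    rintro _ ⟨u, rfl⟩
    by_cases hu : f u = 0
    · left; simp [hu]
    · right; exact ⟨u, hf hu, rfl⟩
  have := le_ciSup hb x
  rwa [add_sub_cancel_left] at this

theorem supConv_nonneg {d : ℕ} {f g : (Fin d → ℤ) → ℝ} (hf : ∀ x, 0 ≤ f x) (hg : ∀ x, 0 ≤ g x)
    (z : Fin d → ℤ) : 0 ≤ supConv f g z :=
  Real.iSup_nonneg fun x => mul_nonneg (hf x) (hg _)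

theorem support_supConv_subset {d : ℕ} {f g : (Fin d → ℤ) → ℝ} (hf : Function.support f ⊆ cube d)
    (hg : Function.support g ⊆ cube d) :
    Function.support (supConv f g) ⊆ Set.range (ofDigits (n := 5) (d := d)) := by
  intro z hz
  by_contra hn
  apply hz
  have : ∀ x, f x * g (z - x) = 0 := by
    intro x
    by_contra h
    have := add_mem_range_ofDigits (hf (left_ne_zero_of_mul h)) (hg (right_ne_zero_of_mul h))
    rw [add_sub_cancel] at this
    exact hn this
  simp [supConv, this]

/-- The comparisons `5² ≤ 3³` and `3¹⁶ ≤ 5¹¹`. -/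
theorem exponent_bounds : 4 / 3 ≤ 2 * Real.log 3 / Real.log 5 ∧
    2 * Real.log 3 / Real.log 5 ≤ 11 / 8 := by
  have h5 : 0 < Real.log 5 := Real.log_pos (by norm_num)
  constructor
  · have : Real.log (5 ^ 2) ≤ Real.log (3 ^ 3) := Real.log_le_log (by norm_num) (by norm_num)
    rw [Real.log_pow, Real.log_pow] at this
    rw [le_div_iff₀ h5]
    push_cast at this
    linarith
  · have : Real.log (3 ^ 16) ≤ Real.log (5 ^ 11) := Real.log_le_log (by norm_num) (by norm_num)
    rw [Real.log_pow, Real.log_pow] at this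
    rw [div_le_iff₀ h5]
    push_cast at this
    linarith

theorem ellNorm_mul_ellNorm_le {d : ℕ} {f g : (Fin d → ℤ) → ℝ} (hf : ∀ x, 0 ≤ f x)
    (hg : ∀ x, 0 ≤ g x) (hfs : Function.support f ⊆ cube d) (hgs : Function.support g ⊆ cube d) :
    ellNorm (2 * Real.log 3 / Real.log 5) f * ellNorm (2 * Real.log 3 / Real.log 5) g ≤
      ellNorm 1 (supConv f g) := by
  obtain ⟨hq0, hq⟩ := exponent_bounds
  have h5 : 0 < Real.log 5 := Real.log_pos (by norm_num)
  rw [ellNorm_eq_sum (n := 3) (by linarith) hf (by rwa [range_ofDigits_three]),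
    ellNorm_eq_sum (n := 3) (by linarith) hg (by rwa [range_ofDigits_three]),
    ellNorm_eq_sum (n := 5) one_pos (supConv_nonneg hf hg) (support_supConv_subset hfs hgs)]
  simp only [Real.rpow_one, div_one]
  refine lp_mul_lp_le_sum hq0 hq (by field_simp) d _ _ _ (fun x => hf _) (fun x => hg _) ?_
  intro x y
  rw [← ofDigits_add]
  exact le_supConv hfs _ _

/-! ### Cardinalities of sumsets -/

theorem ellNorm_indicator {d : ℕ} {r : ℝ} (hr : 0 < r) (A : Finset (Fin d → ℤ)) :
    ellNorm r ((A : Set (Fin d → ℤ)).indicator 1) = (A.card : ℝ) ^ (1 / r) := by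
  unfold ellNorm
  rw [tsum_eq_sum (s := A)]
  · rw [Finset.sum_congr rfl (g := fun _ => (1 : ℝ))]
    · simp
    · intro x hx; simp [hx]
  · intro x hx; simp [hx, Real.zero_rpow hr.ne']

theorem supConv_indicator {d : ℕ} {A B : Finset (Fin d → ℤ)}
    (hA : (A : Set (Fin d → ℤ)) ⊆ cube d) :
    supConv ((A : Set (Fin d → ℤ)).indicator 1) ((B : Set (Fin d → ℤ)).indicator 1) =
      ((A + B : Finset (Fin d → ℤ)) : Set (Fin d → ℤ)).indicator 1 := by
  funext z
  by_cases hz : z ∈ A + B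
  · rw [Set.indicator_of_mem (by exact_mod_cast hz)]
    apply le_antisymm
    · refine ciSup_le fun x => ?_
      simp only [Set.indicator_apply, Pi.one_apply]
      split_ifs <;> norm_num
    · obtain ⟨x, hx, y, hy, rfl⟩ := Finset.mem_add.1 hz
      refine le_trans ?_ (le_supConv (Set.support_indicator_subset.trans hA) x y)
      simp [hx, hy]
  · rw [Set.indicator_of_notMem (by exact_mod_cast hz)]
    have : ∀ x, (A : Set (Fin d → ℤ)).indicator (1 : (Fin d → ℤ) → ℝ) x *
        (B : Set (Fin d → ℤ)).indicator (1 : (Fin d → ℤ) → ℝ) (z - x) = 0 := by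
      intro x
      by_cases hx : x ∈ A
      · have : z - x ∉ B := fun h => hz (Finset.mem_add.2 ⟨x, hx, _, h, add_sub_cancel _ _⟩)
        simp [this]
      · simp [hx]
    simp [supConv, this]

theorem card_rpow_mul_card_rpow_le {d : ℕ} {A B : Finset (Fin d → ℤ)}
    (hA : (A : Set (Fin d → ℤ)) ⊆ cube d) (hB : (B : Set (Fin d → ℤ)) ⊆ cube d) :
    (A.card : ℝ) ^ (Real.log 5 / (2 * Real.log 3)) * (B.card : ℝ) ^ (Real.log 5 / (2 * Real.log 3)) ≤
      ((A + B).card : ℝ) := by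
  have hq0 := exponent_bounds.1
  have hnn : ∀ A : Finset (Fin d → ℤ), ∀ x,
      0 ≤ (A : Set (Fin d → ℤ)).indicator (1 : (Fin d → ℤ) → ℝ) x :=
    fun A => Set.indicator_nonneg fun _ _ => zero_le_one
  have h := ellNorm_mul_ellNorm_le (hnn A) (hnn B) (Set.support_indicator_subset.trans hA)
    (Set.support_indicator_subset.trans hB)
  rw [supConv_indicator hA, ellNorm_indicator (by linarith), ellNorm_indicator (by linarith),
    ellNorm_indicator one_pos, one_div_div, one_div_one, Real.rpow_one] at h
  exact h

/-- The full cube `A = B = {0, 1, 2}^d` shows that the exponent cannot be improved. -/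
theorem exponent_le {d : ℕ} (hd : 1 ≤ d) {p : ℝ}
    (hp : ∀ A B : Finset (Fin d → ℤ),
      (A : Set (Fin d → ℤ)) ⊆ cube d → (B : Set (Fin d → ℤ)) ⊆ cube d →
      (A.card : ℝ) ^ p * (B.card : ℝ) ^ p ≤ ((A + B).card : ℝ)) :
    p ≤ Real.log 5 / (2 * Real.log 3) := by
  let C : Finset (Fin d → ℤ) := Finset.univ.image (ofDigits (n := 3))
  have hC : (C : Set (Fin d → ℤ)) ⊆ cube d := by
    simp [C, range_ofDigits_three]
  have hcard : C.card = 3 ^ d := by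
    rw [Finset.card_image_of_injective _ ofDigits_injective]; simp
  have hadd : (C + C).card ≤ 5 ^ d := by
    have hsub : C + C ⊆ Finset.univ.image (ofDigits (n := 5)) := by
      intro z hz
      obtain ⟨x, hx, y, hy, rfl⟩ := Finset.mem_add.1 hz
      simpa using add_mem_range_ofDigits (hC hx) (hC hy)
    refine (Finset.card_le_card hsub).trans (Finset.card_image_le.trans_eq ?_)
    simp
  have h := (hp C C hC hC).trans (Nat.cast_le.2 hadd)
  rw [hcard] at h
  push_cast at h
  have h3 : 0 < Real.log 3 := Real.log_pos (by norm_num)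
  have hlog := Real.log_le_log (by positivity) h
  rw [Real.log_mul (by positivity) (by positivity), Real.log_rpow (by positivity), Real.log_pow,
    Real.log_pow] at hlog
  have hd' : (0 : ℝ) < d := by exact_mod_cast hd
  rw [le_div_iff₀ (by positivity)]
  refine le_of_mul_le_mul_left ?_ hd'
  linarith

end SumsetCube

theorem theorem1p1 (d : ℕ) (hd : 1 ≤ d) :
    (∀ f g : (Fin d → ℤ) → ℝ, (∀ x, 0 ≤ f x) → (∀ x, 0 ≤ g x) →
      Function.support f ⊆ SumsetCube.cube d → Function.support g ⊆ SumsetCube.cube d →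
      SumsetCube.ellNorm (2 * Real.log 3 / Real.log 5) f *
          SumsetCube.ellNorm (2 * Real.log 3 / Real.log 5) g ≤
        SumsetCube.ellNorm 1 (SumsetCube.supConv f g)) ∧
    IsGreatest
      {p : ℝ | ∀ A B : Finset (Fin d → ℤ),
        (A : Set (Fin d → ℤ)) ⊆ SumsetCube.cube d → (B : Set (Fin d → ℤ)) ⊆ SumsetCube.cube d →
        (A.card : ℝ) ^ p * (B.card : ℝ) ^ p ≤ ((A + B).card : ℝ)}
      (Real.log 5 / (2 * Real.log 3)) :=
  ⟨fun _ _ hf hg hfs hgs => SumsetCube.ellNorm_mul_ellNorm_le hf hg hfs hgs,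
    fun _ _ hA hB => SumsetCube.card_rpow_mul_card_rpow_le hA hB,
    fun _ hp => SumsetCube.exponent_le hd hp⟩
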